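/- Let $\mathbb H$ be a real-rational proper transfer function with all poles strictly inside the unit disc, and let $S_w(\theta)=|\mathbb H(e^{j\theta})|^2$ be the associated noise spectrum. Assume $S_w(\theta)>0$ for all $\theta$ and $S_w$ is not constant. Let $P>0$ and let $h\ge 0$ be an integer; $\log$ is the natural logarithm (rates in nats), with $\log t=-\infty$ for $t\le 0$. Let $C_{fb}(h)$ be the supremum of $$\frac1{4\pi}\int_{-\pi}^{\pi}\log\big((1+a(\theta))^2+b(\theta)^2\big)\,d\theta$$ over all real $a,b\in L_2[-\pi,\pi]$ such that $\frac1{2\pi}\int_{-\pi}^{\pi}(a^2+b^2)S_w\,d\theta\le P$ and $$\int_{-\pi}^{\pi}a(\theta)\cos(n\theta)\,d\theta+\int_{-\pi}^{\pi}b(\theta)\sin(n\theta)\,d\theta=0,\qquad n=0,1,\dots,h .$$ Put $A(\theta)=[\cos\theta,\dots,\cos h\theta]'$ and $B(\theta)=[\sin\theta,\dots,\sin h\theta]'$, and for $\lambda>0$, $\eta\in\mathbb R^h$, $\eta_0\in\mathbb R$ let $$r^2(\theta)=(2\lambda S_w(\theta)+\eta'A(\theta)+\eta_0)^2+(\eta'B(\theta))^2,\qquad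 \nu_*(\theta)=\frac{-r^2(\theta)+\sqrt{r^4(\theta)+8\lambda S_w(\theta)r^2(\theta)}}{2}.$$ For a continuous function $\nu\ge0$ on $[-\pi,\pi]$ let $$\tilde g(\lambda,\eta,\eta_0,\nu)=\frac1{2\pi}\int_{-\pi}^{\pi}\Big[\tfrac12\log(2\lambda S_w-\nu)-\frac{r^2}{2\nu}+\lambda S_w\Big]d\theta-\lambda P+\eta_0+\tfrac12\ \in[-\infty,\infty)$$ (with $r^2/0=+\infty$ if $r\neq0$ and $0/0=0$), and $g(\lambda,\eta,\eta_0)=\tilde g(\lambda,\eta,\eta_0,\nu_*)$. Then there is a real number $\mu_h$ such that the following hold. a) The Lagrangian dual of $C_{fb}(h)$ is $\mu_h=-\max_{\lambda>0,\,\eta\in\mathbb R^h,\,\eta_0\in\mathbb R}g(\lambda,\eta,\eta_0)$, and the maximum is attained. That is, write the primal as the minimisation of the negative objective, and take multipliers $\lambda\ge0$ for the power constraint and $-\eta_0,-\eta$ for the causality constraints $n=0$ and $n=1,\dots,h$, each divided by $2\pi$. Then the infimum of the Lagrangian over $a,b\in L_2$ equals $g(\lambda,\eta,\eta_0)$ (which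 is finite) if $\lambda>0$, and equals $-\infty$ if $\lambda=0$; its supremum over all multipliers with $\lambda\ge0$ is $-\mu_h$. b) The dual problem is equivalent to the convex problem $\mu_h=-\max\tilde g(\lambda,\eta,\eta_0,\nu)$ over $\lambda>0$, $\eta\in\mathbb R^h$, $\eta_0\in\mathbb R$ and continuous $\nu\ge0$ on $[-\pi,\pi]$: the function $\tilde g$ is jointly concave there and the maximum is attained. For fixed $(\lambda,\eta,\eta_0)$ the function $\nu_*$ is admissible and is the unique maximiser over $\nu$. Hence $(\lambda,\eta,\eta_0,\nu)$ is optimal if and only if $(\lambda,\eta,\eta_0)$ maximises $g$ and $\nu=\nu_*$. c) There is no duality gap, $C_{fb}(h)=\mu_h$, and an optimal filter $a(\theta)+jb(\theta)$ for $C_{fb}(h)$ exists. For every optimal $(\lambda,\eta,\eta_0)$ of the problem in a) with $\nu=\nu_*$, and for every optimal $(\lambda,\eta,\eta_0,\nu)$ of the problem in b), a pair $(a,b)$ is optimal if and only if $$a(\theta)=\frac{2\lambda S_w(\theta)+\eta'A(\theta)+\eta_0}{\nu(\theta)}-1,\qquad b(\theta)=\frac{\eta'B(\theta)}{\nu(\theta)}\qquad\text{for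 a.e. }\theta\in[-\pi,\pi].$$ -/

import Mathlib

open MeasureTheory Set

noncomputable section

namespace FeedbackCapacity

/-- `H` is the transfer function (in the variable `z` of the `z`-transform) of a causal stable
linear time-invariant finite-dimensional system: it is real-rational, proper, and all its complex
poles lie strictly inside the unit disc. -/
def IsCausalStable (H : RatFunc ℝ) : Prop :=
  H.intDegree ≤ 0 ∧ ∀ z : ℂ, H.denom.eval₂ (algebraMap ℝ ℂ) z = 0 → ‖z‖ < 1

/-- The power spectral density `S_w(θ) = |H(e^{jθ})|²` of the output of the system `H` driven by
unit-variance white noise. -/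
def psd (H : RatFunc ℝ) (θ : ℝ) : ℝ :=
  ‖H.eval (algebraMap ℝ ℂ) (Complex.exp (θ * Complex.I))‖ ^ 2

/-- Lebesgue measure on `[-π, π]`. -/
def circ : Measure ℝ := volume.restrict (Icc (-Real.pi) Real.pi)

/-- The Lebesgue integral over `[-π, π]` of an extended-real-valued function: integral of the
positive part minus integral of the negative part. In all uses below the positive part has a
finite integral, so that the value is a real number or `-∞`. -/
def extIntegral (f : ℝ → EReal) : EReal :=
  ((∫⁻ θ, (f θ).toENNReal ∂circ : ENNReal) : EReal) -
    ((∫⁻ θ, (-f θ).toENNReal ∂circ : ENNReal) : EReal)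

/-- The logarithm of a real number as an extended real number, with `elog t = -∞` for `t ≤ 0`. -/
def elog (t : ℝ) : EReal := ENNReal.log (ENNReal.ofReal t)

/-! ### The primal problem -/

/-- The set `Γ` of pairs of square-integrable functions on `[-π, π]`. -/
def MemGamma (a b : ℝ → ℝ) : Prop := MemLp a 2 circ ∧ MemLp b 2 circ

/-- The objective `(1/4π) ∫ log ((1 + a)² + b²) dθ ∈ [-∞, ∞)`. -/
def rate (a b : ℝ → ℝ) : EReal :=
  ((1 / (4 * Real.pi) : ℝ) : EReal) * extIntegral (fun θ => elog ((1 + a θ) ^ 2 + b θ ^ 2))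

/-- The average power `(1/2π) ∫ (a² + b²) S dθ`. -/
def power (S a b : ℝ → ℝ) : ℝ :=
  1 / (2 * Real.pi) * ∫ θ, (a θ ^ 2 + b θ ^ 2) * S θ ∂circ

/-- The left-hand side of the `n`-th causality constraint. -/
def causality (a b : ℝ → ℝ) (n : ℕ) : ℝ :=
  (∫ θ, a θ * Real.cos (n * θ) ∂circ) + ∫ θ, b θ * Real.sin (n * θ) ∂circ

/-- Feasibility for the `h`-truncated problem. -/
def IsFeasible (S : ℝ → ℝ) (P : ℝ) (h : ℕ) (a b : ℝ → ℝ) : Prop :=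
  MemGamma a b ∧ power S a b ≤ P ∧ ∀ n : ℕ, n ≤ h → causality a b n = 0

/-- The optimal value `C_fb(h)` of the `h`-truncated problem. -/
def Cfb (S : ℝ → ℝ) (P : ℝ) (h : ℕ) : EReal :=
  ⨆ (a : ℝ → ℝ) (b : ℝ → ℝ) (_ : IsFeasible S P h a b), rate a b

/-- `a + j b` is an optimal filter for the `h`-truncated problem. -/
def IsOptimalFilter (S : ℝ → ℝ) (P : ℝ) (h : ℕ) (a b : ℝ → ℝ) : Prop :=
  IsFeasible S P h a b ∧ rate a b = Cfb S P h

/-! ### The Lagrangian dual -/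

/-- The Lagrangian of the `h`-truncated problem, written as the minimisation of `-rate`, with
multiplier `lam` of the power constraint and multipliers `η₀`, `η` of the causality constraints
`n = 0` and `n = 1, …, h` (each divided by `2π`); `η i` belongs to `n = i + 1`. -/
def lagrangian (S : ℝ → ℝ) (P : ℝ) (h : ℕ) (a b : ℝ → ℝ)
    (lam : ℝ) (η : Fin h → ℝ) (η₀ : ℝ) : EReal :=
  -rate a b +
    ((lam * (power S a b - P)
      - ∑ i, η i * (1 / (2 * Real.pi) * causality a b ((i : ℕ) + 1))
      - η₀ * (1 / (2 * Real.pi) * causality a b 0) : ℝ) : EReal)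

/-- The Lagrangian dual function: the infimum of the Lagrangian over `Γ`. -/
def lagrangeDual (S : ℝ → ℝ) (P : ℝ) (h : ℕ) (lam : ℝ) (η : Fin h → ℝ) (η₀ : ℝ) : EReal :=
  ⨅ (a : ℝ → ℝ) (b : ℝ → ℝ) (_ : MemGamma a b), lagrangian S P h a b lam η η₀

/-- `2 λ S(θ) + η' A(θ) + η₀` with `A(θ) = [cos θ, …, cos hθ]'`. -/
def dualX (S : ℝ → ℝ) (h : ℕ) (lam : ℝ) (η : Fin h → ℝ) (η₀ : ℝ) (θ : ℝ) : ℝ :=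
  2 * lam * S θ + ∑ i : Fin h, η i * Real.cos (((i : ℕ) + 1 : ℝ) * θ) + η₀

/-- `η' B(θ)` with `B(θ) = [sin θ, …, sin hθ]'`. -/
def dualY (h : ℕ) (η : Fin h → ℝ) (θ : ℝ) : ℝ :=
  ∑ i : Fin h, η i * Real.sin (((i : ℕ) + 1 : ℝ) * θ)

/-- The function `r²(θ)`. -/
def rsq (S : ℝ → ℝ) (h : ℕ) (lam : ℝ) (η : Fin h → ℝ) (η₀ : ℝ) (θ : ℝ) : ℝ :=
  dualX S h lam η η₀ θ ^ 2 + dualY h η θ ^ 2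

/-- The closed form of `ν(θ)`. -/
def nuOpt (S : ℝ → ℝ) (h : ℕ) (lam : ℝ) (η : Fin h → ℝ) (η₀ : ℝ) (θ : ℝ) : ℝ :=
  (-rsq S h lam η η₀ θ +
    Real.sqrt (rsq S h lam η η₀ θ ^ 2 + 8 * lam * S θ * rsq S h lam η η₀ θ)) / 2

/-- The integrand of the dual objective `g`, with `ν` given by the closed form `nuOpt`. -/
def gIntegrand (S : ℝ → ℝ) (h : ℕ) (lam : ℝ) (η : Fin h → ℝ) (η₀ : ℝ) (θ : ℝ) : ℝ :=
  1 / 2 * Real.log (2 * lam * S θ - nuOpt S h lam η η₀ θ)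
    - rsq S h lam η η₀ θ / (2 * nuOpt S h lam η η₀ θ) + lam * S θ

/-- The dual objective `g(λ, η, η₀)`. -/
def g (S : ℝ → ℝ) (P : ℝ) (h : ℕ) (lam : ℝ) (η : Fin h → ℝ) (η₀ : ℝ) : ℝ :=
  1 / (2 * Real.pi) * (∫ θ, gIntegrand S h lam η η₀ θ ∂circ) - lam * P + η₀ + 1 / 2

/-- `(lam, η, η₀)` is a maximiser of the dual problem. -/
def IsDualOptimal (S : ℝ → ℝ) (P : ℝ) (h : ℕ) (lam : ℝ) (η : Fin h → ℝ) (η₀ : ℝ) : Prop :=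
  0 < lam ∧ ∀ (lam' : ℝ) (η' : Fin h → ℝ) (η₀' : ℝ), 0 < lam' →
    g S P h lam' η' η₀' ≤ g S P h lam η η₀

/-! ### The dual with free `ν` -/

/-- The objective `g̃(λ, η, η₀, ν) ∈ [-∞, ∞)`, with the usual conventions `log t = -∞` for
`t ≤ 0`, `r²/0 = +∞` for `r ≠ 0`, and `0/0 = 0`. -/
def gTilde (S : ℝ → ℝ) (P : ℝ) (h : ℕ) (lam : ℝ) (η : Fin h → ℝ) (η₀ : ℝ) (ν : ℝ → ℝ) : EReal :=
  ((1 / (2 * Real.pi) : ℝ) : EReal) *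
      extIntegral (fun θ =>
        ((1 / 2 : ℝ) : EReal) * elog (2 * lam * S θ - ν θ)
          - ((ENNReal.ofReal (rsq S h lam η η₀ θ) / ENNReal.ofReal (2 * ν θ) : ENNReal) : EReal)
          + ((lam * S θ : ℝ) : EReal))
    + ((-lam * P + η₀ + 1 / 2 : ℝ) : EReal)

/-- The admissible `ν`: non-negative continuous functions on `[-π, π]`. -/
def IsAdmissibleNu (ν : ℝ → ℝ) : Prop :=
  ContinuousOn ν (Icc (-Real.pi) Real.pi) ∧ ∀ θ ∈ Icc (-Real.pi) Real.pi, 0 ≤ ν θ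

/-- `(lam, η, η₀, ν)` is a maximiser of the dual problem with free `ν`. -/
def IsFreeDualOptimal (S : ℝ → ℝ) (P : ℝ) (h : ℕ)
    (lam : ℝ) (η : Fin h → ℝ) (η₀ : ℝ) (ν : ℝ → ℝ) : Prop :=
  0 < lam ∧ IsAdmissibleNu ν ∧
    ∀ (lam' : ℝ) (η' : Fin h → ℝ) (η₀' : ℝ) (ν' : ℝ → ℝ), 0 < lam' → IsAdmissibleNu ν' →
      gTilde S P h lam' η' η₀' ν' ≤ gTilde S P h lam η η₀ ν

/-- `a` and `b` are a.e. on `[-π, π]` the functions `(2λS + η'A + η₀)/ν - 1` and `η'B/ν`. -/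
def IsDualFilter (S : ℝ → ℝ) (h : ℕ) (lam : ℝ) (η : Fin h → ℝ) (η₀ : ℝ) (ν : ℝ → ℝ)
    (a b : ℝ → ℝ) : Prop :=
  (∀ᵐ θ ∂circ, a θ = dualX S h lam η η₀ θ / ν θ - 1) ∧
    ∀ᵐ θ ∂circ, b θ = dualY h η θ / ν θ

end FeedbackCapacity

end

noncomputable section

namespace FeedbackCapacity

/-! ### Integration over `[-π, π]` -/

/-! The primal objective `log ((1 + a)² + b²)` is not concave, so convex duality does not apply
directly. Instead, the Lagrangian is minimised pointwise. With `x = 1 + a`, `y = b`, `p = 2λS`, `X =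
dualX` and `Y = dualY`, its integrand is `-½ log (x² + y²) + (p/2)(x² + y²) - xX - yY` plus terms
independent of `x, y`. Bounding the logarithm by its tangent with slope `p - ν` leaves a quadratic
of leading coefficient `ν/2`; completing the square puts its minimum at `(X, Y)/ν`. The tangent
bound is an equality there exactly when `ν² = r²(p - ν)`, whose nonnegative root is `nuOpt`
(`pointwise_lagrangian_ge`, `pointwise_lagrangian_eq`). Thus `g` is the dual function, and the
minimiser is unique a.e. (`lagrangian_eq_g_iff`) because `r ≠ 0` a.e.: `r²` is real-analytic, and it
can vanish identically only for a constant spectrum (`psd_isRegularSpectrum`).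

Optimal multipliers exist because the dual function is upper semicontinuous and coercive. Coercivity
comes from the test filters `t e^{jnθ}`, each of which sees only the `n`-th causality constraint
(`exists_lagrangeDual_le`, `exists_isDualOptimal`). Frequency `h + 1` sees none, so the dual is `-∞`
at `λ = 0`.

The gap closes by an envelope argument. Perturb optimal multipliers in a direction and follow the
pointwise minimisers: optimality makes the constraint functional in that direction nonpositive on
them, and dominated convergence passes this to the unperturbed filter (`penalty_dualFilter_nonpos`).
Reversing the direction makes every constraint functional vanish. The filter is then feasible with
rate `-g`, which meets weak duality.

For free `ν`, the closed form is the unique pointwise maximiser (`pointwise_free_le`), and joint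
concavity comes from concavity of the logarithm and convexity of `(X² + Y²)/(2n)`
(`quotient_convex`). -/

instance isFiniteMeasure_circ : IsFiniteMeasure circ := by
  unfold circ; infer_instance

lemma circ_univ : circ univ = ENNReal.ofReal (2 * Real.pi) := by
  simp [circ, two_mul]

lemma circ_real_univ : circ.real univ = 2 * Real.pi := by
  rw [Measure.real, circ_univ, ENNReal.toReal_ofReal (by positivity)]

lemma integral_circ (f : ℝ → ℝ) : ∫ θ, f θ ∂circ = ∫ θ in -Real.pi..Real.pi, f θ := by
  rw [circ, integral_Icc_eq_integral_Ioc,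
    intervalIntegral.integral_of_le (by linarith [Real.pi_pos])]

lemma integrable_circ_of_continuousOn {f : ℝ → ℝ} (hf : ContinuousOn f (Icc (-Real.pi) Real.pi)) :
    Integrable f circ :=
  hf.integrableOn_Icc

lemma aemeasurable_circ_of_continuousOn {f : ℝ → ℝ} (hf : ContinuousOn f (Icc (-Real.pi) Real.pi)) :
    AEMeasurable f circ :=
  hf.aemeasurable measurableSet_Icc

lemma ae_circ_of_forall {p : ℝ → Prop} (hp : ∀ θ ∈ Icc (-Real.pi) Real.pi, p θ) :
    ∀ᵐ θ ∂circ, p θ :=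
  (ae_restrict_iff' measurableSet_Icc).2 (Filter.Eventually.of_forall hp)

lemma integral_circ_cos {c : ℤ} (hc : c ≠ 0) : ∫ θ, Real.cos (c * θ) ∂circ = 0 := by
  have hc' : (c : ℝ) ≠ 0 := by exact_mod_cast hc
  rw [integral_circ, intervalIntegral.integral_comp_mul_left (fun x => Real.cos x) hc']
  simp [Real.sin_int_mul_pi]

lemma integral_circ_cos_sub (n m : ℕ) :
    ∫ θ, Real.cos ((n - m : ℝ) * θ) ∂circ = if n = m then 2 * Real.pi else 0 := by
  split_ifs with hnm
  · simp [hnm, circ_real_univ]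
  · have := integral_circ_cos (c := (n : ℤ) - m) (by omega)
    simpa using this

lemma integral_circ_sin_mul_sin (n m : ℕ) :
    ∫ θ, Real.sin ((n + 1 : ℝ) * θ) * Real.sin ((m + 1 : ℝ) * θ) ∂circ
      = if n = m then Real.pi else 0 := by
  have h1 : ∀ θ : ℝ, Real.sin ((n + 1 : ℝ) * θ) * Real.sin ((m + 1 : ℝ) * θ) =
      1 / 2 * Real.cos ((n - m : ℝ) * θ) - 1 / 2 * Real.cos (((n + m + 2 : ℤ) : ℝ) * θ) := by
    intro θ
    have e1 : (n - m : ℝ) * θ = (n + 1 : ℝ) * θ - (m + 1 : ℝ) * θ := by ring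
    have e2 : ((n + m + 2 : ℤ) : ℝ) * θ = (n + 1 : ℝ) * θ + (m + 1 : ℝ) * θ := by
      push_cast; ring
    rw [e1, e2, Real.cos_sub, Real.cos_add]; ring
  simp_rw [h1]
  rw [integral_sub, integral_const_mul, integral_const_mul, integral_circ_cos_sub,
    integral_circ_cos (by omega)]
  · split_ifs <;> ring
  all_goals exact integrable_circ_of_continuousOn (by fun_prop)

/-! ### The extended integral -/

lemma extIntegral_mono_ae {f f' : ℝ → EReal} (hf : ∀ᵐ θ ∂circ, f θ ≤ f' θ) :
    extIntegral f ≤ extIntegral f' := by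
  refine EReal.sub_le_sub ?_ ?_
  · exact_mod_cast lintegral_mono_ae (hf.mono fun θ hθ => EReal.toENNReal_le_toENNReal hθ)
  · exact_mod_cast lintegral_mono_ae
      (hf.mono fun θ hθ => EReal.toENNReal_le_toENNReal (EReal.neg_le_neg_iff.2 hθ))

lemma extIntegral_congr_ae {f f' : ℝ → EReal} (hf : ∀ᵐ θ ∂circ, f θ = f' θ) :
    extIntegral f = extIntegral f' :=
  le_antisymm (extIntegral_mono_ae (hf.mono fun _ hθ => hθ.le))
    (extIntegral_mono_ae (hf.mono fun _ hθ => hθ.ge))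

lemma extIntegral_coe {φ : ℝ → ℝ} (hφ : Integrable φ circ) :
    extIntegral (fun θ => (φ θ : EReal)) = ((∫ θ, φ θ ∂circ : ℝ) : EReal) := by
  have hp : ∫⁻ θ, ENNReal.ofReal (φ θ) ∂circ ≠ ⊤ := hφ.lintegral_lt_top.ne
  have hn : ∫⁻ θ, ENNReal.ofReal (-φ θ) ∂circ ≠ ⊤ := hφ.neg.lintegral_lt_top.ne
  have hneg : ∀ θ, (-(φ θ : EReal)).toENNReal = ENNReal.ofReal (-φ θ) := fun θ => by
    rw [← EReal.coe_neg, EReal.real_coe_toENNReal]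
  rw [integral_eq_lintegral_pos_part_sub_lintegral_neg_part hφ, extIntegral]
  simp only [EReal.real_coe_toENNReal, hneg]
  rw [EReal.coe_sub, EReal.coe_ennreal_toReal hp, EReal.coe_ennreal_toReal hn]

/-- The majorant makes the positive part integrable, so only the negative part can have infinite
integral. This reduces the extended integrals below to ordinary ones or to a trivial case. -/
lemma extIntegral_eq_bot_or {f : ℝ → EReal} (hf : AEMeasurable f circ) {φ : ℝ → ℝ}
    (hφ : Integrable φ circ) (hle : ∀ᵐ θ ∂circ, f θ ≤ φ θ) :
    extIntegral f = ⊥ ∨ ∃ ψ : ℝ → ℝ, Integrable ψ circ ∧ ∀ᵐ θ ∂circ, f θ = ψ θ := by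
  have hpos : ∫⁻ θ, (f θ).toENNReal ∂circ ≠ ⊤ := by
    refine ne_top_of_le_ne_top hφ.lintegral_lt_top.ne (lintegral_mono_ae ?_)
    exact hle.mono fun θ hθ => EReal.toENNReal_le_toENNReal hθ
  by_cases htop : ∫⁻ θ, (-f θ).toENNReal ∂circ = ⊤
  · left
    rw [extIntegral, htop]
    simp
  · right
    have hmneg : AEMeasurable (fun θ => (-f θ).toENNReal) circ :=
      (measurable_ereal_toENNReal.comp (continuous_neg.measurable)).comp_aemeasurable hf
    have hfin := ae_lt_top' hmneg htop
    have hreal : ∀ᵐ θ ∂circ, f θ = ((f θ).toReal : EReal) := by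
      filter_upwards [hle, hfin] with θ h1 h2
      rw [EReal.coe_toReal]
      · exact ne_top_of_le_ne_top (EReal.coe_ne_top _) h1
      · intro h; simp [h] at h2
    refine ⟨fun θ => (f θ).toReal, ⟨hf.ereal_toReal.aestronglyMeasurable, ?_⟩, hreal⟩
    have hle' : ∫⁻ θ, ‖(f θ).toReal‖ₑ ∂circ ≤
        ∫⁻ θ, ((f θ).toENNReal + (-f θ).toENNReal) ∂circ := by
      refine lintegral_mono_ae (hreal.mono fun θ hθ => ?_)
      rw [hθ, ← EReal.coe_neg, EReal.real_coe_toENNReal, EReal.real_coe_toENNReal,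
        EReal.toReal_coe, Real.enorm_eq_ofReal_abs]
      rcases le_total 0 (f θ).toReal with h | h
      · rw [abs_of_nonneg h]; exact le_self_add
      · rw [abs_of_nonpos h]; exact le_add_self
    refine hle'.trans_lt ?_
    rw [lintegral_add_right' _ hmneg]
    exact ENNReal.add_lt_top.2 ⟨hpos.lt_top, Ne.lt_top htop⟩

/-! ### The extended logarithm -/

lemma elog_of_pos {t : ℝ} (ht : 0 < t) : elog t = (Real.log t : EReal) :=
  ENNReal.log_ofReal_of_pos ht

lemma elog_of_nonpos {t : ℝ} (ht : t ≤ 0) : elog t = ⊥ := by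
  rw [elog, ENNReal.log_ofReal, if_pos ht]

lemma elog_mono {s t : ℝ} (hst : s ≤ t) : elog s ≤ elog t :=
  ENNReal.log_monotone (ENNReal.ofReal_le_ofReal hst)

lemma pos_of_elog_eq_coe {t c : ℝ} (h : elog t = (c : EReal)) : 0 < t := by
  by_contra ht
  rw [elog_of_nonpos (not_lt.1 ht)] at h
  exact EReal.bot_ne_coe _ h

lemma elog_le_coe (t : ℝ) : elog t ≤ ((|t| : ℝ) : EReal) := by
  rcases le_or_gt t 0 with ht | ht
  · simp [elog_of_nonpos ht]
  · rw [elog_of_pos ht]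
    exact_mod_cast (Real.log_le_sub_one_of_pos ht).trans (by linarith [le_abs_self t])

lemma measurable_elog : Measurable elog :=
  ENNReal.log_monotone.measurable.comp ENNReal.measurable_ofReal

/-! ### Pointwise optimisation -/

lemma rsq_nonneg (S : ℝ → ℝ) (h : ℕ) (lam : ℝ) (η : Fin h → ℝ) (η₀ θ : ℝ) :
    0 ≤ rsq S h lam η η₀ θ := by
  unfold rsq; positivity

section nuOpt

variable {S : ℝ → ℝ} {h : ℕ} {lam : ℝ} {η : Fin h → ℝ} {η₀ θ : ℝ}

/-- The quadratic equation solved by the closed form. It is also the stationarity condition in `ν`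
of `½ log (p - ν) - r²/(2ν)`; later arguments use it in place of the square root. -/
lemma nuOpt_sq (hlam : 0 < lam) (hS : 0 < S θ) :
    nuOpt S h lam η η₀ θ ^ 2 =
      rsq S h lam η η₀ θ * (2 * lam * S θ - nuOpt S h lam η η₀ θ) := by
  have hq := rsq_nonneg S h lam η η₀ θ
  have hs := Real.sq_sqrt (show 0 ≤ rsq S h lam η η₀ θ ^ 2 + 8 * lam * S θ * rsq S h lam η η₀ θ by
    positivity)
  unfold nuOpt
  linear_combination hs / 4

lemma nuOpt_nonneg (hlam : 0 < lam) (hS : 0 < S θ) : 0 ≤ nuOpt S h lam η η₀ θ := by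
  have hq := rsq_nonneg S h lam η η₀ θ
  have : rsq S h lam η η₀ θ ≤
      Real.sqrt (rsq S h lam η η₀ θ ^ 2 + 8 * lam * S θ * rsq S h lam η η₀ θ) :=
    Real.le_sqrt_of_sq_le (le_add_of_nonneg_right (by positivity))
  unfold nuOpt; linarith

lemma nuOpt_eq_zero_iff (hlam : 0 < lam) (hS : 0 < S θ) :
    nuOpt S h lam η η₀ θ = 0 ↔ rsq S h lam η η₀ θ = 0 := by
  constructor
  · intro h0
    have := nuOpt_sq (h := h) (η := η) (η₀ := η₀) hlam hS
    rw [h0] at this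
    have hp : 2 * lam * S θ ≠ 0 := by positivity
    simpa [hp] using this.symm
  · intro h0
    simp [nuOpt, h0]

lemma nuOpt_lt (hlam : 0 < lam) (hS : 0 < S θ) :
    0 < 2 * lam * S θ - nuOpt S h lam η η₀ θ := by
  rcases (nuOpt_nonneg (h := h) (η := η) (η₀ := η₀) hlam hS).eq_or_lt with h0 | h0
  · rw [← h0]; simp; positivity
  · have := nuOpt_sq (h := h) (η := η) (η₀ := η₀) hlam hS
    exact pos_of_mul_pos_right (this ▸ pow_pos h0 2) (rsq_nonneg ..)

lemma nuOpt_pos (hlam : 0 < lam) (hS : 0 < S θ) (hr : rsq S h lam η η₀ θ ≠ 0) :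
    0 < nuOpt S h lam η η₀ θ :=
  lt_of_le_of_ne (nuOpt_nonneg hlam hS) fun h0 => hr ((nuOpt_eq_zero_iff hlam hS).1 h0.symm)

end nuOpt

/-- The right-hand form has no singularity at `ν = 0`, which is what makes `gIntegrand` continuous
across zeros of `r`. -/
lemma quotient_eq_of_sq {p q ν : ℝ} (hν : ν ^ 2 = q * (p - ν)) (hp : 0 < p - ν) :
    q / (2 * ν) = ν / (2 * (p - ν)) := by
  rcases eq_or_ne ν 0 with h0 | h0
  · simp [h0]
  · rw [div_eq_div_iff (by positivity) (by positivity)]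
    linear_combination -2 * hν

/-- The pointwise Lagrangian is bounded below by its minimal value plus a quadratic excess. -/
lemma pointwise_lagrangian_ge {p X Y ν x y : ℝ} (hν : ν ^ 2 = (X ^ 2 + Y ^ 2) * (p - ν))
    (hp : 0 < p - ν) (hxy : 0 < x ^ 2 + y ^ 2) :
    1 / 2 * Real.log (p - ν) - ν / (2 * (p - ν)) + 1 / 2
        + ν / 2 * ((x - X / ν) ^ 2 + (y - Y / ν) ^ 2) ≤
      -(1 / 2 * Real.log (x ^ 2 + y ^ 2)) + p / 2 * (x ^ 2 + y ^ 2) - x * X - y * Y := by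
  -- Tangent to the logarithm at `x² + y² = 1/(p - ν)`, the squared modulus of the minimiser when `ν
  -- ≠ 0`.
  have hlog := Real.log_le_sub_one_of_pos (mul_pos hxy hp)
  rw [Real.log_mul hxy.ne' hp.ne'] at hlog
  rw [← quotient_eq_of_sq hν hp]
  rcases eq_or_ne ν 0 with h0 | h0
  · subst h0
    have hXY : X ^ 2 + Y ^ 2 = 0 := by
      have : (X ^ 2 + Y ^ 2) * (p - 0) = 0 := by rw [← hν]; ring
      exact (mul_eq_zero.1 this).resolve_right hp.ne'
    have hX : X = 0 := by nlinarith
    have hY : Y = 0 := by nlinarith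
    subst hX hY
    simp only [sub_zero] at hlog
    simp
    linarith
  · have e : ν / 2 * ((x - X / ν) ^ 2 + (y - Y / ν) ^ 2) =
        ν / 2 * (x ^ 2 + y ^ 2) - x * X - y * Y + (X ^ 2 + Y ^ 2) / (2 * ν) := by
      field_simp
      ring
    rw [e]
    linarith

lemma pointwise_lagrangian_eq {p X Y ν : ℝ} (hν : ν ^ 2 = (X ^ 2 + Y ^ 2) * (p - ν))
    (hp : 0 < p - ν) (h0 : ν ≠ 0) :
    -(1 / 2 * Real.log ((X / ν) ^ 2 + (Y / ν) ^ 2)) + p / 2 * ((X / ν) ^ 2 + (Y / ν) ^ 2)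
        - X / ν * X - Y / ν * Y =
      1 / 2 * Real.log (p - ν) - ν / (2 * (p - ν)) + 1 / 2 := by
  have e : (X / ν) ^ 2 + (Y / ν) ^ 2 = (p - ν)⁻¹ := by
    rw [div_pow, div_pow, ← add_div, div_eq_iff (pow_ne_zero 2 h0), hν]
    field_simp
  have e2 : X / ν * X + Y / ν * Y = ν / (p - ν) := by
    have : X / ν * X + Y / ν * Y = ν * ((X / ν) ^ 2 + (Y / ν) ^ 2) := by
      field_simp
    rw [this, e, div_eq_mul_inv]
  have e3 : p / 2 * (p - ν)⁻¹ = 1 / 2 + ν / (2 * (p - ν)) := by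
    have := hp.ne'
    field_simp
    ring
  have e4 : ν / (p - ν) = 2 * (ν / (2 * (p - ν))) := by
    have := hp.ne'
    field_simp
  rw [e, Real.log_inv, e3]
  linarith

/-- The integrand of the dual with free `ν` is bounded above by its maximal value minus a
quadratic deficit. -/
lemma pointwise_free_le {p q ν n : ℝ} (hν : ν ^ 2 = q * (p - ν)) (hp : 0 < p - ν)
    (hn : 0 < n) (hnp : 0 < p - n) :
    1 / 2 * Real.log (p - n) - q / (2 * n) + (n - ν) ^ 2 / (2 * n * (p - ν)) ≤
      1 / 2 * Real.log (p - ν) - ν / (2 * (p - ν)) := by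
  -- Tangent to the logarithm at `p - ν`; the quotient term is then expanded exactly and supplies
  -- the quadratic deficit.
  have hlog := Real.log_le_sub_one_of_pos (div_pos hnp hp)
  rw [Real.log_div hnp.ne' hp.ne'] at hlog
  have hq : q = ν ^ 2 / (p - ν) := by rw [hν, mul_div_cancel_right₀ _ hp.ne']
  have e : (p - n) / (p - ν) - 1 = (ν - n) / (p - ν) := by
    rw [div_sub_one hp.ne']; congr 1; ring
  have e2 : q / (2 * n) - (n - ν) ^ 2 / (2 * n * (p - ν)) =
      ν / (2 * (p - ν)) + 1 / 2 * ((ν - n) / (p - ν)) := by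
    have := hp.ne'
    rw [hq]
    field_simp
    ring
  linarith

/-- The integrand of the dual with free `ν`. -/
def freeIntegrand (p q c n : ℝ) : EReal :=
  ((1 / 2 : ℝ) : EReal) * elog (p - n)
    - ((ENNReal.ofReal q / ENNReal.ofReal (2 * n) : ENNReal) : EReal) + (c : EReal)

lemma freeIntegrand_eq_coe {p q c n : ℝ} (hq : 0 ≤ q) (hn : 0 ≤ n) (hpn : 0 < p - n)
    (hnq : n = 0 → q = 0) :
    freeIntegrand p q c n =
      ((1 / 2 * Real.log (p - n) - q / (2 * n) + c : ℝ) : EReal) := by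
  have : ((ENNReal.ofReal q / ENNReal.ofReal (2 * n) : ENNReal) : EReal) =
      ((q / (2 * n) : ℝ) : EReal) := by
    rcases hn.eq_or_lt with h0 | h0
    · simp [← h0, hnq h0.symm]
    · rw [← ENNReal.ofReal_div_of_pos (by positivity), EReal.coe_ennreal_ofReal,
        max_eq_left (by positivity)]
  rw [freeIntegrand, elog_of_pos hpn, this]
  push_cast
  ring_nf

lemma freeIntegrand_eq_bot_or {p q c n : ℝ} (hq : 0 ≤ q) (hn : 0 ≤ n) :
    freeIntegrand p q c n = ⊥ ∨ (0 < p - n ∧ (n = 0 → q = 0)) := by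
  rcases le_or_gt (p - n) 0 with hpn | hpn
  · left
    rw [freeIntegrand, elog_of_nonpos hpn, EReal.coe_mul_bot_of_pos (by norm_num)]
    simp
  by_cases hnq : n = 0 → q = 0
  · exact Or.inr ⟨hpn, hnq⟩
  · left
    push Not at hnq
    obtain ⟨rfl, hq0⟩ := hnq
    have hq' : 0 < q := lt_of_le_of_ne hq hq0.symm
    have : ENNReal.ofReal q / ENNReal.ofReal (2 * 0) = ⊤ := by
      simp [ENNReal.div_zero, hq']
    rw [freeIntegrand, this]
    simp

lemma freeIntegrand_le {p q c n ν : ℝ} (hq : 0 ≤ q) (hν : ν ^ 2 = q * (p - ν)) (hp : 0 < p - ν)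
    (hn : 0 ≤ n) :
    freeIntegrand p q c n ≤
      ((1 / 2 * Real.log (p - ν) - ν / (2 * (p - ν)) + c : ℝ) : EReal) := by
  rcases freeIntegrand_eq_bot_or (p := p) (c := c) hq hn with hb | ⟨hpn, hnq⟩
  · rw [hb]; exact bot_le
  rw [freeIntegrand_eq_coe hq hn hpn hnq, EReal.coe_le_coe_iff]
  rcases hn.eq_or_lt with h0 | h0
  · have hν0 : ν = 0 := by
      have := hnq h0.symm
      rw [this, zero_mul] at hν
      exact pow_eq_zero_iff two_ne_zero |>.1 hν
    simp [← h0, hν0]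
  · have := pointwise_free_le hν hp h0 hpn
    have : 0 ≤ (n - ν) ^ 2 / (2 * n * (p - ν)) := by positivity
    linarith

lemma freeIntegrand_eq_iff {p q c n ν : ℝ} (hq : 0 ≤ q) (hν : ν ^ 2 = q * (p - ν))
    (hp : 0 < p - ν) (hn : 0 ≤ n) :
    freeIntegrand p q c n =
      ((1 / 2 * Real.log (p - ν) - ν / (2 * (p - ν)) + c : ℝ) : EReal) ↔ n = ν := by
  constructor
  · intro he
    rcases freeIntegrand_eq_bot_or (p := p) (c := c) hq hn with hb | ⟨hpn, hnq⟩
    · rw [hb] at he; exact absurd he (EReal.bot_ne_coe _)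
    rw [freeIntegrand_eq_coe hq hn hpn hnq, EReal.coe_eq_coe_iff] at he
    rcases hn.eq_or_lt with h0 | h0
    · have := hnq h0.symm
      rw [this, zero_mul] at hν
      rw [pow_eq_zero_iff two_ne_zero |>.1 hν, h0]
    · have h1 := pointwise_free_le hν hp h0 hpn
      have h2 : (n - ν) ^ 2 / (2 * n * (p - ν)) ≤ 0 := by linarith
      have h3 : (n - ν) ^ 2 ≤ 0 := by
        by_contra h4
        exact absurd h2 (not_le.2 (div_pos (not_le.1 h4) (by positivity)))
      nlinarith
  · rintro rfl
    rw [freeIntegrand_eq_coe hq hn hp, quotient_eq_of_sq hν hp]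
    rintro rfl
    have : q * (p - 0) = 0 := by rw [← hν]; ring
    exact (mul_eq_zero.1 this).resolve_right hp.ne'

/-- The function `(X, Y, n) ↦ (X² + Y²) / (2 n)` is convex, including the degenerate case
`X = Y = n = 0`. -/
lemma quotient_convex {X₁ Y₁ X₂ Y₂ n₁ n₂ α β : ℝ} (hn₁ : 0 ≤ n₁) (hn₂ : 0 ≤ n₂)
    (h₁ : n₁ = 0 → X₁ ^ 2 + Y₁ ^ 2 = 0) (h₂ : n₂ = 0 → X₂ ^ 2 + Y₂ ^ 2 = 0)
    (hα : 0 ≤ α) (hβ : 0 ≤ β) :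
    ((α * X₁ + β * X₂) ^ 2 + (α * Y₁ + β * Y₂) ^ 2) / (2 * (α * n₁ + β * n₂)) ≤
      α * ((X₁ ^ 2 + Y₁ ^ 2) / (2 * n₁)) + β * ((X₂ ^ 2 + Y₂ ^ 2) / (2 * n₂)) := by
  have zero_of : ∀ {x y : ℝ}, x ^ 2 + y ^ 2 = 0 → x = 0 ∧ y = 0 := fun {x y} hxy =>
    ⟨by nlinarith, by nlinarith⟩
  have scale : ∀ {γ x y n : ℝ}, ((γ * x) ^ 2 + (γ * y) ^ 2) / (2 * (γ * n)) =
      γ * ((x ^ 2 + y ^ 2) / (2 * n)) := by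
    intro γ x y n
    rcases eq_or_ne γ 0 with rfl | hγ
    · simp
    rcases eq_or_ne n 0 with rfl | hn
    · simp
    field_simp
  rcases hn₁.eq_or_lt with h0 | h0₁
  · obtain ⟨rfl, rfl⟩ := zero_of (h₁ h0.symm)
    subst h0
    simpa using (scale (γ := β)).le
  rcases hn₂.eq_or_lt with h0 | h0₂
  · obtain ⟨rfl, rfl⟩ := zero_of (h₂ h0.symm)
    subst h0
    simpa using (scale (γ := α)).le
  rcases (add_nonneg (mul_nonneg hα hn₁) (mul_nonneg hβ hn₂)).eq_or_lt with h0 | hpos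
  · rw [← h0]
    simp only [mul_zero, div_zero]
    positivity
  rw [← sub_nonneg]
  -- The convexity gap of this perspective function is an explicit sum of squares.
  have : α * ((X₁ ^ 2 + Y₁ ^ 2) / (2 * n₁)) + β * ((X₂ ^ 2 + Y₂ ^ 2) / (2 * n₂)) -
      ((α * X₁ + β * X₂) ^ 2 + (α * Y₁ + β * Y₂) ^ 2) / (2 * (α * n₁ + β * n₂)) =
      α * β * ((n₂ * X₁ - n₁ * X₂) ^ 2 + (n₂ * Y₁ - n₁ * Y₂) ^ 2) /
        (2 * n₁ * n₂ * (α * n₁ + β * n₂)) := by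
    field_simp
    ring
  rw [this]
  positivity

lemma le_freeIntegrand_combo {p₁ X₁ Y₁ c₁ n₁ p₂ X₂ Y₂ c₂ n₂ α β t₁ t₂ : ℝ}
    (hn₁ : 0 ≤ n₁) (hn₂ : 0 ≤ n₂)
    (h₁ : freeIntegrand p₁ (X₁ ^ 2 + Y₁ ^ 2) c₁ n₁ = (t₁ : EReal))
    (h₂ : freeIntegrand p₂ (X₂ ^ 2 + Y₂ ^ 2) c₂ n₂ = (t₂ : EReal))
    (hα : 0 ≤ α) (hβ : 0 ≤ β) (hαβ : α + β = 1) :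
    ((α * t₁ + β * t₂ : ℝ) : EReal) ≤
      freeIntegrand (α * p₁ + β * p₂) ((α * X₁ + β * X₂) ^ 2 + (α * Y₁ + β * Y₂) ^ 2)
        (α * c₁ + β * c₂) (α * n₁ + β * n₂) := by
  have hq₁ : 0 ≤ X₁ ^ 2 + Y₁ ^ 2 := by positivity
  have hq₂ : 0 ≤ X₂ ^ 2 + Y₂ ^ 2 := by positivity
  rcases freeIntegrand_eq_bot_or (p := p₁) (c := c₁) hq₁ hn₁ with hb | ⟨hp₁, hz₁⟩
  · rw [hb] at h₁; exact absurd h₁ (EReal.bot_ne_coe _)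
  rcases freeIntegrand_eq_bot_or (p := p₂) (c := c₂) hq₂ hn₂ with hb | ⟨hp₂, hz₂⟩
  · rw [hb] at h₂; exact absurd h₂ (EReal.bot_ne_coe _)
  rw [freeIntegrand_eq_coe hq₁ hn₁ hp₁ hz₁, EReal.coe_eq_coe_iff] at h₁
  rw [freeIntegrand_eq_coe hq₂ hn₂ hp₂ hz₂, EReal.coe_eq_coe_iff] at h₂
  have hcomb : α * p₁ + β * p₂ - (α * n₁ + β * n₂) = α * (p₁ - n₁) + β * (p₂ - n₂) := by ring
  have hpc : 0 < α * p₁ + β * p₂ - (α * n₁ + β * n₂) := by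
    rw [hcomb]
    exact (convex_Ioi (0 : ℝ)) hp₁ hp₂ hα hβ hαβ
  have hlog := strictConcaveOn_log_Ioi.concaveOn.2 (mem_Ioi.2 hp₁) (mem_Ioi.2 hp₂) hα hβ hαβ
  simp only [smul_eq_mul] at hlog
  have hquot := quotient_convex hn₁ hn₂ hz₁ hz₂ hα hβ
  rw [freeIntegrand_eq_coe (by positivity) (by positivity) hpc, EReal.coe_le_coe_iff, hcomb]
  · subst h₁ h₂
    linarith
  -- If the combined `n` vanishes, each summand has zero weight or zero `n`. Either way its `X`, `Y`
  -- contribution vanishes, so the convention `0/0 = 0` applies.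
  · intro h0
    obtain ⟨e₁, e₂⟩ := (add_eq_zero_iff_of_nonneg (mul_nonneg hα hn₁) (mul_nonneg hβ hn₂)).1 h0
    have vanish : ∀ {γ x y n : ℝ}, γ * n = 0 → (n = 0 → x ^ 2 + y ^ 2 = 0) →
        γ * x = 0 ∧ γ * y = 0 := by
      intro γ x y n hγ hz
      rcases mul_eq_zero.1 hγ with h | h
      · simp [h]
      · obtain ⟨hx, hy⟩ := (add_eq_zero_iff_of_nonneg (sq_nonneg x) (sq_nonneg y)).1 (hz h)
        rw [pow_eq_zero_iff two_ne_zero] at hx hy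
        simp [hx, hy]
    obtain ⟨f₁, f₁'⟩ := vanish e₁ hz₁
    obtain ⟨f₂, f₂'⟩ := vanish e₂ hz₂
    rw [f₁, f₁', f₂, f₂']
    norm_num

/-! ### Properties of the spectrum -/

/-- The properties of a noise spectrum on which the duality theory depends. -/
structure IsRegularSpectrum (S : ℝ → ℝ) : Prop where
  continuous : Continuous S
  pos : ∀ θ, 0 < S θ
  rsq_ne_zero : ∀ {h : ℕ} {lam : ℝ} (η : Fin h → ℝ) (η₀ : ℝ), 0 < lam →
    ∀ᵐ θ ∂circ, rsq S h lam η η₀ θ ≠ 0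

lemma psd_analyticOnNhd {H : RatFunc ℝ} (hpos : ∀ θ : ℝ, 0 < psd H θ) :
    AnalyticOnNhd ℝ (psd H) univ := by
  intro θ _
  have hpoly : ∀ p : Polynomial ℝ, AnalyticAt ℂ
      (fun w : ℂ => p.eval₂ (algebraMap ℝ ℂ) (Complex.exp (w * Complex.I))) θ := by
    intro p
    have houter : Differentiable ℂ fun z : ℂ => (p.map (algebraMap ℝ ℂ)).eval z :=
      Polynomial.differentiable _
    have hinner : Differentiable ℂ fun w : ℂ => Complex.exp (w * Complex.I) := by fun_prop
    simp_rw [← Polynomial.eval_map]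
    exact (houter.comp hinner).analyticAt _
  -- At a zero of the denominator, division by zero would give `psd` the value `0`, contradicting
  -- positivity.
  have hden : H.denom.eval₂ (algebraMap ℝ ℂ) (Complex.exp (θ * Complex.I)) ≠ 0 := by
    intro h0
    have := hpos θ
    simp [psd, RatFunc.eval, h0] at this
  have hF := (hpoly H.num).div (hpoly H.denom) hden
  have he : psd H = fun t : ℝ =>
      (H.eval (algebraMap ℝ ℂ) (Complex.exp (t * Complex.I))).re ^ 2 +
        (H.eval (algebraMap ℝ ℂ) (Complex.exp (t * Complex.I))).im ^ 2 := by
    funext t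
    rw [psd, ← Complex.normSq_eq_norm_sq, Complex.normSq_apply]
    ring
  rw [he]
  exact (hF.re_ofReal.pow 2).add (hF.im_ofReal.pow 2)

/-- Orthogonality of the sines isolates each coefficient. -/
lemma eq_zero_of_dualY_eq_zero {h : ℕ} {η : Fin h → ℝ} (hY : ∀ θ, dualY h η θ = 0) : η = 0 := by
  funext k
  have h1 : ∫ θ, dualY h η θ * Real.sin (((k : ℕ) + 1 : ℝ) * θ) ∂circ = η k * Real.pi := by
    simp_rw [dualY, Finset.sum_mul, mul_assoc]
    rw [integral_finsetSum]
    · simp_rw [integral_const_mul, integral_circ_sin_mul_sin, Fin.val_inj]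
      simp
    · intro i _
      exact integrable_circ_of_continuousOn (by fun_prop)
  simp only [hY, zero_mul, integral_zero] at h1
  simpa [Real.pi_ne_zero] using h1.symm

lemma psd_isRegularSpectrum {H : RatFunc ℝ} (hpos : ∀ θ : ℝ, 0 < psd H θ)
    (hcolored : ¬ ∃ c : ℝ, ∀ θ : ℝ, psd H θ = c) : IsRegularSpectrum (psd H) where
  continuous := continuousOn_univ.1 (psd_analyticOnNhd hpos).continuousOn
  pos := hpos
  rsq_ne_zero := by
    intro h lam η η₀ hlam
    have han : AnalyticOnNhd ℝ (rsq (psd H) h lam η η₀) univ := by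
      intro θ hθ
      have hS := psd_analyticOnNhd hpos θ hθ
      unfold rsq dualX dualY
      have hcos : ∀ c : ℝ, AnalyticAt ℝ (fun t : ℝ => Real.cos (c * t)) θ := fun c =>
        Real.analyticAt_cos.comp (by fun_prop)
      have hsin : ∀ c : ℝ, AnalyticAt ℝ (fun t : ℝ => Real.sin (c * t)) θ := fun c =>
        Real.analyticAt_sin.comp (by fun_prop)
      fun_prop
    -- Analytic dichotomy: an identically zero `r²` forces `η = 0` and then `S = -η₀/(2λ)`, a
    -- constant; otherwise the zero set is discrete, hence null.
    rcases han.eqOn_zero_or_eventually_ne_zero_of_preconnected isPreconnected_univ with h0 | h0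
    · exfalso
      have hXY : ∀ θ, dualX (psd H) h lam η η₀ θ = 0 ∧ dualY h η θ = 0 := fun θ => by
        have := h0 (mem_univ θ)
        simp only [rsq, Pi.zero_apply] at this
        rw [add_eq_zero_iff_of_nonneg (sq_nonneg _) (sq_nonneg _)] at this
        simpa using this
      have hη := eq_zero_of_dualY_eq_zero fun θ => (hXY θ).2
      subst hη
      refine hcolored ⟨-η₀ / (2 * lam), fun θ => ?_⟩
      have := (hXY θ).1
      simp only [dualX, Pi.zero_apply, zero_mul, Finset.sum_const_zero, add_zero] at this
      rw [eq_div_iff (by positivity)]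
      linarith
    · have := ae_restrict_le_codiscreteWithin (μ := volume) MeasurableSet.univ h0
      rw [Measure.restrict_univ] at this
      exact ae_restrict_of_ae this

/-! ### Continuity in the multipliers and the frequency -/

section continuity

variable {S : ℝ → ℝ}

lemma continuous_dualX_uncurry (hS : Continuous S) (h : ℕ) :
    Continuous fun q : (ℝ × (Fin h → ℝ) × ℝ) × ℝ => dualX S h q.1.1 q.1.2.1 q.1.2.2 q.2 := by
  unfold dualX; fun_prop

lemma continuous_dualY_uncurry (h : ℕ) :
    Continuous fun q : (ℝ × (Fin h → ℝ) × ℝ) × ℝ => dualY h q.1.2.1 q.2 := by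
  unfold dualY; fun_prop

lemma continuous_nuOpt_uncurry (hS : Continuous S) (h : ℕ) :
    Continuous fun q : (ℝ × (Fin h → ℝ) × ℝ) × ℝ => nuOpt S h q.1.1 q.1.2.1 q.1.2.2 q.2 := by
  have hX := continuous_dualX_uncurry hS h
  have hY := continuous_dualY_uncurry h
  unfold nuOpt rsq; fun_prop

variable {h : ℕ} (lam : ℝ) (η : Fin h → ℝ) (η₀ : ℝ)

lemma continuous_dualX (hS : Continuous S) : Continuous (dualX S h lam η η₀) :=
  (continuous_dualX_uncurry hS h).comp
    (f := fun θ : ℝ => ((lam, η, η₀), θ)) (by fun_prop)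

lemma continuous_dualY : Continuous (dualY h η) := by
  unfold dualY; fun_prop

lemma continuous_nuOpt (hS : Continuous S) : Continuous (nuOpt S h lam η η₀) :=
  (continuous_nuOpt_uncurry hS h).comp
    (f := fun θ : ℝ => ((lam, η, η₀), θ)) (by fun_prop)

end continuity

lemma integrable_circ_mul_continuous {f f' : ℝ → ℝ} (hf : Integrable f circ)
    (hf' : Continuous f') : Integrable (fun θ => f θ * f' θ) circ :=
  IntegrableOn.mul_continuousOn hf hf'.continuousOn isCompact_Icc

/-! ### The Lagrangian as an integral -/

/-- The multiplier part of the Lagrangian. -/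
def penalty (S : ℝ → ℝ) (P : ℝ) (h : ℕ) (a b : ℝ → ℝ)
    (lam : ℝ) (η : Fin h → ℝ) (η₀ : ℝ) : ℝ :=
  lam * (power S a b - P)
    - ∑ i, η i * (1 / (2 * Real.pi) * causality a b ((i : ℕ) + 1))
    - η₀ * (1 / (2 * Real.pi) * causality a b 0)

lemma lagrangian_eq (S : ℝ → ℝ) (P : ℝ) (h : ℕ) (a b : ℝ → ℝ)
    (lam : ℝ) (η : Fin h → ℝ) (η₀ : ℝ) :
    lagrangian S P h a b lam η η₀ = -rate a b + (penalty S P h a b lam η η₀ : EReal) := rfl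

/-- The integrand of the multiplier part of the Lagrangian. -/
def penaltyIntegrand (S : ℝ → ℝ) (h : ℕ) (a b : ℝ → ℝ)
    (lam : ℝ) (η : Fin h → ℝ) (η₀ : ℝ) (θ : ℝ) : ℝ :=
  lam * ((a θ ^ 2 + b θ ^ 2) * S θ) - a θ * (dualX S h lam η η₀ θ - 2 * lam * S θ)
    - b θ * dualY h η θ

lemma MemGamma.integrable_left {a b : ℝ → ℝ} (hab : MemGamma a b) : Integrable a circ :=
  hab.1.integrable one_le_two

lemma MemGamma.integrable_right {a b : ℝ → ℝ} (hab : MemGamma a b) : Integrable b circ :=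
  hab.2.integrable one_le_two

lemma MemGamma.integrable_sq_add_sq {a b : ℝ → ℝ} (hab : MemGamma a b) :
    Integrable (fun θ => a θ ^ 2 + b θ ^ 2) circ :=
  hab.1.integrable_sq.add hab.2.integrable_sq

lemma MemGamma.causality_eq {a b : ℝ → ℝ} (hab : MemGamma a b) (n : ℕ) :
    causality a b n = ∫ θ, (a θ * Real.cos (n * θ) + b θ * Real.sin (n * θ)) ∂circ := by
  rw [causality, integral_add]
  · exact integrable_circ_mul_continuous hab.integrable_left (by fun_prop)
  · exact integrable_circ_mul_continuous hab.integrable_right (by fun_prop)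

lemma MemGamma.integrable_causality {a b : ℝ → ℝ} (hab : MemGamma a b) (n : ℕ) :
    Integrable (fun θ => a θ * Real.cos (n * θ) + b θ * Real.sin (n * θ)) circ :=
  (integrable_circ_mul_continuous hab.integrable_left (by fun_prop)).add
    (integrable_circ_mul_continuous hab.integrable_right (by fun_prop))

lemma MemGamma.integrable_penaltyIntegrand {a b : ℝ → ℝ} (hab : MemGamma a b)
    {S : ℝ → ℝ} (hS : Continuous S) {h : ℕ} (lam : ℝ) (η : Fin h → ℝ) (η₀ : ℝ) :
    Integrable (penaltyIntegrand S h a b lam η η₀) circ := by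
  refine (((integrable_circ_mul_continuous hab.integrable_sq_add_sq hS).const_mul lam).sub
    (integrable_circ_mul_continuous hab.integrable_left ?_)).sub
    (integrable_circ_mul_continuous hab.integrable_right (continuous_dualY η))
  exact (continuous_dualX lam η η₀ hS).sub (by fun_prop)

lemma MemGamma.penalty_eq {a b : ℝ → ℝ} (hab : MemGamma a b)
    {S : ℝ → ℝ} (hS : Continuous S) (P : ℝ) {h : ℕ} (lam : ℝ) (η : Fin h → ℝ) (η₀ : ℝ) :
    penalty S P h a b lam η η₀ =
      1 / (2 * Real.pi) * ∫ θ, penaltyIntegrand S h a b lam η η₀ θ ∂circ - lam * P := by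
  have hint : ∀ θ, penaltyIntegrand S h a b lam η η₀ θ =
      lam * ((a θ ^ 2 + b θ ^ 2) * S θ)
        - ∑ i : Fin h, η i * (a θ * Real.cos (((i : ℕ) + 1 : ℕ) * θ)
            + b θ * Real.sin (((i : ℕ) + 1 : ℕ) * θ))
        - η₀ * (a θ * Real.cos ((0 : ℕ) * θ) + b θ * Real.sin ((0 : ℕ) * θ)) := by
    intro θ
    have e : dualX S h lam η η₀ θ - 2 * lam * S θ =
      ∑ i : Fin h, η i * Real.cos (((i : ℕ) + 1 : ℝ) * θ) + η₀ := by unfold dualX; ring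
    rw [penaltyIntegrand, e, dualY, mul_add, Finset.mul_sum, Finset.mul_sum]
    simp only [mul_add, Finset.sum_add_distrib, Nat.cast_add, Nat.cast_one, Nat.cast_zero,
      zero_mul, Real.cos_zero, Real.sin_zero, mul_one, mul_zero, add_zero, mul_left_comm (a θ),
      mul_left_comm (b θ)]
    ring
  have h1 := (integrable_circ_mul_continuous hab.integrable_sq_add_sq hS).const_mul lam
  have h2 : Integrable (fun θ => ∑ i : Fin h, η i * (a θ * Real.cos (((i : ℕ) + 1 : ℕ) * θ)
      + b θ * Real.sin (((i : ℕ) + 1 : ℕ) * θ))) circ :=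
    integrable_finsetSum _ fun i _ => (hab.integrable_causality _).const_mul _
  have h3 := (hab.integrable_causality 0).const_mul η₀
  have h12 : Integrable (fun θ => lam * ((a θ ^ 2 + b θ ^ 2) * S θ)
      - ∑ i : Fin h, η i * (a θ * Real.cos (((i : ℕ) + 1 : ℕ) * θ)
        + b θ * Real.sin (((i : ℕ) + 1 : ℕ) * θ))) circ := h1.sub h2
  simp_rw [hint]
  rw [integral_sub h12 h3, integral_sub h1 h2,
    integral_finsetSum _ fun i _ => (hab.integrable_causality _).const_mul _]
  simp_rw [integral_const_mul, ← hab.causality_eq]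
  have hsum : ∑ i : Fin h, η i * (1 / (2 * Real.pi) * causality a b ((i : ℕ) + 1)) =
      1 / (2 * Real.pi) * ∑ i : Fin h, η i * causality a b ((i : ℕ) + 1) := by
    rw [Finset.mul_sum]
    exact Finset.sum_congr rfl fun i _ => by ring
  rw [penalty, power, hsum]
  ring

lemma rate_eq_coe {a b : ℝ → ℝ}
    (hlog : Integrable (fun θ => Real.log ((1 + a θ) ^ 2 + b θ ^ 2)) circ)
    (hpos : ∀ᵐ θ ∂circ, 0 < (1 + a θ) ^ 2 + b θ ^ 2) :
    rate a b = ((1 / (4 * Real.pi) * ∫ θ, Real.log ((1 + a θ) ^ 2 + b θ ^ 2) ∂circ : ℝ) :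
      EReal) := by
  have he : extIntegral (fun θ => elog ((1 + a θ) ^ 2 + b θ ^ 2)) =
      extIntegral (fun θ => (Real.log ((1 + a θ) ^ 2 + b θ ^ 2) : EReal)) :=
    extIntegral_congr_ae (hpos.mono fun θ hθ => elog_of_pos hθ)
  rw [rate, he, extIntegral_coe hlog, EReal.coe_mul]

lemma MemGamma.rate_eq_bot_or {a b : ℝ → ℝ} (hab : MemGamma a b) :
    rate a b = ⊥ ∨ (Integrable (fun θ => Real.log ((1 + a θ) ^ 2 + b θ ^ 2)) circ ∧
      ∀ᵐ θ ∂circ, 0 < (1 + a θ) ^ 2 + b θ ^ 2) := by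
  have hmem : MemLp (fun θ => 1 + a θ) 2 circ :=
    (memLp_const (1 : ℝ)).add hab.1
  have hint : Integrable (fun θ => (1 + a θ) ^ 2 + b θ ^ 2) circ :=
    hmem.integrable_sq.add hab.2.integrable_sq
  rcases extIntegral_eq_bot_or (f := fun θ => elog ((1 + a θ) ^ 2 + b θ ^ 2))
    (measurable_elog.comp_aemeasurable hint.aemeasurable) hint.abs
    (Filter.Eventually.of_forall fun θ => elog_le_coe _) with h0 | ⟨ψ, hψ, he⟩
  · left
    rw [rate, h0, EReal.coe_mul_bot_of_pos (by positivity)]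
  · right
    have hpos : ∀ᵐ θ ∂circ, 0 < (1 + a θ) ^ 2 + b θ ^ 2 :=
      he.mono fun θ hθ => pos_of_elog_eq_coe hθ
    refine ⟨hψ.congr ?_, hpos⟩
    filter_upwards [he, hpos] with θ h1 h2
    rw [elog_of_pos h2, EReal.coe_eq_coe_iff] at h1
    exact h1.symm

lemma MemGamma.integrable_lagrangian {a b : ℝ → ℝ} (hab : MemGamma a b)
    (hlog : Integrable (fun θ => Real.log ((1 + a θ) ^ 2 + b θ ^ 2)) circ)
    {S : ℝ → ℝ} (hS : Continuous S) {h : ℕ} (lam : ℝ) (η : Fin h → ℝ) (η₀ : ℝ) :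
    Integrable (fun θ => -(1 / 2 * Real.log ((1 + a θ) ^ 2 + b θ ^ 2))
      + penaltyIntegrand S h a b lam η η₀ θ) circ :=
  (hlog.const_mul _).neg.add (hab.integrable_penaltyIntegrand hS ..)

/-- The Lagrangian of a pair of finite rate. -/
lemma MemGamma.lagrangian_eq_coe {a b : ℝ → ℝ} (hab : MemGamma a b)
    (hlog : Integrable (fun θ => Real.log ((1 + a θ) ^ 2 + b θ ^ 2)) circ)
    (hpos : ∀ᵐ θ ∂circ, 0 < (1 + a θ) ^ 2 + b θ ^ 2) {S : ℝ → ℝ} (hS : Continuous S)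
    (P : ℝ) {h : ℕ} (lam : ℝ) (η : Fin h → ℝ) (η₀ : ℝ) :
    lagrangian S P h a b lam η η₀ =
      ((1 / (2 * Real.pi) * ∫ θ, (-(1 / 2 * Real.log ((1 + a θ) ^ 2 + b θ ^ 2))
        + penaltyIntegrand S h a b lam η η₀ θ) ∂circ - lam * P : ℝ) : EReal) := by
  have hneg : Integrable (fun θ => -(1 / 2 * Real.log ((1 + a θ) ^ 2 + b θ ^ 2))) circ :=
    (hlog.const_mul _).neg
  rw [lagrangian_eq, rate_eq_coe hlog hpos, ← EReal.coe_neg, ← EReal.coe_add,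
    hab.penalty_eq hS, integral_add hneg (hab.integrable_penaltyIntegrand hS ..),
    integral_neg, integral_const_mul]
  congr 1
  ring

/-! ### The dual objective -/

lemma gIntegrand_eq {S : ℝ → ℝ} (hS : IsRegularSpectrum S) {h : ℕ} {lam : ℝ}
    (η : Fin h → ℝ) (η₀ : ℝ) (hlam : 0 < lam) (θ : ℝ) :
    gIntegrand S h lam η η₀ θ = 1 / 2 * Real.log (2 * lam * S θ - nuOpt S h lam η η₀ θ)
      - nuOpt S h lam η η₀ θ / (2 * (2 * lam * S θ - nuOpt S h lam η η₀ θ)) + lam * S θ := by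
  rw [gIntegrand, quotient_eq_of_sq (nuOpt_sq hlam (hS.pos θ)) (nuOpt_lt hlam (hS.pos θ))]

lemma continuous_gIntegrand {S : ℝ → ℝ} (hS : IsRegularSpectrum S) {h : ℕ} {lam : ℝ}
    (η : Fin h → ℝ) (η₀ : ℝ) (hlam : 0 < lam) : Continuous (gIntegrand S h lam η η₀) := by
  have h1 := continuous_nuOpt lam η η₀ hS.continuous
  have h2 := hS.continuous
  have h3 : ∀ θ, 2 * lam * S θ - nuOpt S h lam η η₀ θ ≠ 0 := fun θ =>
    (nuOpt_lt hlam (hS.pos θ)).ne'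
  rw [funext (gIntegrand_eq hS η η₀ hlam)]
  refine ((continuous_const.mul (Continuous.log (by fun_prop) h3)).sub
    (h1.div (by fun_prop) fun θ => mul_ne_zero two_ne_zero (h3 θ))).add (by fun_prop)

lemma integrable_gIntegrand {S : ℝ → ℝ} (hS : IsRegularSpectrum S) {h : ℕ} {lam : ℝ}
    (η : Fin h → ℝ) (η₀ : ℝ) (hlam : 0 < lam) : Integrable (gIntegrand S h lam η η₀) circ :=
  integrable_circ_of_continuousOn (continuous_gIntegrand hS η η₀ hlam).continuousOn

/-- The cosines of nonzero frequency integrate to zero; what remains is the summand `η₀` of `g`. -/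
lemma integral_dualX_sub {S : ℝ → ℝ} {h : ℕ} {lam : ℝ}
    (η : Fin h → ℝ) (η₀ : ℝ) :
    ∫ θ, (dualX S h lam η η₀ θ - 2 * lam * S θ) ∂circ = 2 * Real.pi * η₀ := by
  have e : ∀ θ, dualX S h lam η η₀ θ - 2 * lam * S θ =
      ∑ i : Fin h, η i * Real.cos ((((i : ℕ) + 1 : ℤ) : ℝ) * θ) + η₀ := fun θ => by
    unfold dualX; push_cast; ring
  simp_rw [e]
  rw [integral_add, integral_finsetSum]
  · simp_rw [integral_const_mul]
    rw [Finset.sum_eq_zero fun i _ => by rw [integral_circ_cos (by omega), mul_zero]]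
    simp [circ_real_univ]
  all_goals try intros
  all_goals exact integrable_circ_of_continuousOn (by fun_prop)

/-- `g` as the integral of the pointwise minimum of the Lagrangian. -/
lemma g_eq_integral {S : ℝ → ℝ} (hS : IsRegularSpectrum S) (P : ℝ) {h : ℕ} {lam : ℝ}
    (η : Fin h → ℝ) (η₀ : ℝ) (hlam : 0 < lam) :
    g S P h lam η η₀ = 1 / (2 * Real.pi) * ∫ θ, (gIntegrand S h lam η η₀ θ + 1 / 2
      + (dualX S h lam η η₀ θ - 2 * lam * S θ)) ∂circ - lam * P := by
  have h1 := integrable_gIntegrand hS η η₀ hlam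
  have h2 : Integrable (fun θ => dualX S h lam η η₀ θ - 2 * lam * S θ) circ :=
    integrable_circ_of_continuousOn
      ((continuous_dualX lam η η₀ hS.continuous).sub
        (continuous_const.mul hS.continuous)).continuousOn
  have h3 : Integrable (fun θ => gIntegrand S h lam η η₀ θ + 1 / 2) circ :=
    h1.add (integrable_const _)
  rw [integral_add h3 h2, integral_add h1 (integrable_const _),
    integral_dualX_sub, g]
  simp only [integral_const, circ_real_univ, smul_eq_mul]
  field_simp
  ring

lemma integrable_min_lagrangian {S : ℝ → ℝ} (hS : IsRegularSpectrum S) {h : ℕ} {lam : ℝ}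
    (η : Fin h → ℝ) (η₀ : ℝ) (hlam : 0 < lam) :
    Integrable (fun θ => gIntegrand S h lam η η₀ θ + 1 / 2 + (dualX S h lam η η₀ θ - 2 * lam * S θ)) circ := by
  have h1 := continuous_gIntegrand hS η η₀ hlam
  have h2 := continuous_dualX lam η η₀ hS.continuous
  have h3 := hS.continuous
  exact integrable_circ_of_continuousOn (by fun_prop)

lemma lagrangian_integrand_ge {S : ℝ → ℝ} (hS : IsRegularSpectrum S) {h : ℕ} {lam : ℝ}
    (η : Fin h → ℝ) (η₀ : ℝ) (hlam : 0 < lam) {a b : ℝ → ℝ} {θ : ℝ}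
    (hpos : 0 < (1 + a θ) ^ 2 + b θ ^ 2) :
    gIntegrand S h lam η η₀ θ + 1 / 2 + (dualX S h lam η η₀ θ - 2 * lam * S θ)
        + nuOpt S h lam η η₀ θ / 2 *
          ((1 + a θ - dualX S h lam η η₀ θ / nuOpt S h lam η η₀ θ) ^ 2
            + (b θ - dualY h η θ / nuOpt S h lam η η₀ θ) ^ 2) ≤
      -(1 / 2 * Real.log ((1 + a θ) ^ 2 + b θ ^ 2)) + penaltyIntegrand S h a b lam η η₀ θ := by
  have := pointwise_lagrangian_ge (X := dualX S h lam η η₀ θ) (Y := dualY h η θ)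
    (nuOpt_sq hlam (hS.pos θ)) (nuOpt_lt hlam (hS.pos θ)) hpos
  rw [gIntegrand_eq hS η η₀ hlam, penaltyIntegrand]
  linarith

lemma isDualFilter_iff {S : ℝ → ℝ} {h : ℕ} {lam : ℝ}
    (η : Fin h → ℝ) (η₀ : ℝ) {a b : ℝ → ℝ} {ν : ℝ → ℝ} :
    IsDualFilter S h lam η η₀ ν a b ↔
      ∀ᵐ θ ∂circ, 1 + a θ = dualX S h lam η η₀ θ / ν θ ∧ b θ = dualY h η θ / ν θ := by
  rw [IsDualFilter, ← Filter.eventually_and]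
  refine Filter.eventually_congr (Filter.Eventually.of_forall fun θ => ?_)
  rw [eq_sub_iff_add_eq']

/-- The right side is continuous and positive, even near zeros of `r` where the filter formula
degenerates. This yields square integrability, integrability of the logarithm, and the uniform bound
along perturbed multipliers. -/
lemma sq_add_sq_dualFilter {S : ℝ → ℝ} (hS : IsRegularSpectrum S) {h : ℕ} {lam : ℝ}
    (η : Fin h → ℝ) (η₀ : ℝ) (hlam : 0 < lam) {θ : ℝ} (hr : rsq S h lam η η₀ θ ≠ 0) :
    (dualX S h lam η η₀ θ / nuOpt S h lam η η₀ θ) ^ 2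
      + (dualY h η θ / nuOpt S h lam η η₀ θ) ^ 2 =
      (2 * lam * S θ - nuOpt S h lam η η₀ θ)⁻¹ := by
  have h0 := (nuOpt_pos hlam (hS.pos θ) hr).ne'
  have h1 := (nuOpt_lt (h := h) (η := η) (η₀ := η₀) hlam (hS.pos θ)).ne'
  have h2 := nuOpt_sq (h := h) (η := η) (η₀ := η₀) hlam (hS.pos θ)
  have h3 : dualX S h lam η η₀ θ ^ 2 + dualY h η θ ^ 2 ≠ 0 := hr
  rw [div_pow, div_pow, ← add_div, h2, rsq, div_mul_eq_div_div, div_self h3, one_div]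

lemma continuous_inv_sub_nuOpt {S : ℝ → ℝ} (hS : IsRegularSpectrum S) {h : ℕ} {lam : ℝ}
    (η : Fin h → ℝ) (η₀ : ℝ) (hlam : 0 < lam) :
    Continuous fun θ => (2 * lam * S θ - nuOpt S h lam η η₀ θ)⁻¹ := by
  have h1 := continuous_nuOpt lam η η₀ hS.continuous
  have h2 := hS.continuous
  exact Continuous.inv₀ (by fun_prop) fun θ => (nuOpt_lt hlam (hS.pos θ)).ne'

lemma memGamma_of_isDualFilter {S : ℝ → ℝ} (hS : IsRegularSpectrum S) {h : ℕ} {lam : ℝ}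
    (η : Fin h → ℝ) (η₀ : ℝ) (hlam : 0 < lam) {a b : ℝ → ℝ}
    (hf : IsDualFilter S h lam η η₀ (nuOpt S h lam η η₀) a b) : MemGamma a b := by
  have hI : Integrable (fun θ => (2 * lam * S θ - nuOpt S h lam η η₀ θ)⁻¹) circ :=
    integrable_circ_of_continuousOn (continuous_inv_sub_nuOpt hS η η₀ hlam).continuousOn
  have hν := (continuous_nuOpt lam η η₀ hS.continuous).measurable
  have hX : Measurable fun θ => dualX S h lam η η₀ θ / nuOpt S h lam η η₀ θ :=
    (continuous_dualX lam η η₀ hS.continuous).measurable.div hν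
  have hY : Measurable fun θ => dualY h η θ / nuOpt S h lam η η₀ θ :=
    (continuous_dualY η).measurable.div hν
  have key : ∀ f : ℝ → ℝ, Measurable f →
      (∀ᵐ θ ∂circ, f θ ^ 2 ≤ (2 * lam * S θ - nuOpt S h lam η η₀ θ)⁻¹) → MemLp f 2 circ := by
    intro f hf hle
    refine (memLp_two_iff_integrable_sq hf.aestronglyMeasurable).2
      (hI.mono' (hf.pow_const 2).aestronglyMeasurable ?_)
    filter_upwards [hle] with θ hθ
    rwa [Real.norm_of_nonneg (sq_nonneg _)]
  have hr := hS.rsq_ne_zero η η₀ hlam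
  have hXm := key _ hX <| by
    filter_upwards [hr] with θ hθ
    rw [← sq_add_sq_dualFilter hS η η₀ hlam hθ]
    exact le_add_of_nonneg_right (sq_nonneg _)
  have hYm := key _ hY <| by
    filter_upwards [hr] with θ hθ
    rw [← sq_add_sq_dualFilter hS η η₀ hlam hθ]
    exact le_add_of_nonneg_left (sq_nonneg _)
  refine ⟨(memLp_congr_ae hf.1).2 (hXm.sub (memLp_const 1)), (memLp_congr_ae hf.2).2 hYm⟩

lemma log_integrable_of_isDualFilter {S : ℝ → ℝ} (hS : IsRegularSpectrum S) {h : ℕ} {lam : ℝ}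
    (η : Fin h → ℝ) (η₀ : ℝ) (hlam : 0 < lam) {a b : ℝ → ℝ}
    (hf : IsDualFilter S h lam η η₀ (nuOpt S h lam η η₀) a b) :
    Integrable (fun θ => Real.log ((1 + a θ) ^ 2 + b θ ^ 2)) circ ∧
      ∀ᵐ θ ∂circ, 0 < (1 + a θ) ^ 2 + b θ ^ 2 := by
  have he : ∀ᵐ θ ∂circ, (1 + a θ) ^ 2 + b θ ^ 2 =
      (2 * lam * S θ - nuOpt S h lam η η₀ θ)⁻¹ := by
    filter_upwards [(isDualFilter_iff η η₀).1 hf, hS.rsq_ne_zero η η₀ hlam] with θ h1 h2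
    rw [h1.1, h1.2, sq_add_sq_dualFilter hS η η₀ hlam h2]
  have hp : ∀ θ, 0 < (2 * lam * S θ - nuOpt S h lam η η₀ θ)⁻¹ := fun θ =>
    inv_pos.2 (nuOpt_lt hlam (hS.pos θ))
  refine ⟨?_, he.mono fun θ hθ => hθ ▸ hp θ⟩
  have := integrable_circ_of_continuousOn ((continuous_inv_sub_nuOpt hS η η₀ hlam).log
    fun θ => (hp θ).ne').continuousOn
  exact this.congr (he.mono fun θ hθ => by simp only [hθ])

lemma lagrangian_of_isDualFilter {S : ℝ → ℝ} (hS : IsRegularSpectrum S) (P : ℝ) {h : ℕ} {lam : ℝ}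
    (η : Fin h → ℝ) (η₀ : ℝ) (hlam : 0 < lam) {a b : ℝ → ℝ}
    (hf : IsDualFilter S h lam η η₀ (nuOpt S h lam η η₀) a b) :
    lagrangian S P h a b lam η η₀ = (g S P h lam η η₀ : EReal) := by
  obtain ⟨hlog, hpos⟩ := log_integrable_of_isDualFilter hS η η₀ hlam hf
  rw [(memGamma_of_isDualFilter hS η η₀ hlam hf).lagrangian_eq_coe hlog hpos hS.continuous,
    g_eq_integral hS P η η₀ hlam]
  congr 3
  refine integral_congr_ae ?_
  filter_upwards [(isDualFilter_iff η η₀).1 hf, hS.rsq_ne_zero η η₀ hlam] with θ h1 h2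
  have h3 := pointwise_lagrangian_eq (X := dualX S h lam η η₀ θ) (Y := dualY h η θ)
    (nuOpt_sq hlam (hS.pos θ)) (nuOpt_lt hlam (hS.pos θ)) (nuOpt_pos hlam (hS.pos θ) h2).ne'
  rw [← h1.1, ← h1.2] at h3
  rw [gIntegrand_eq hS η η₀ hlam, penaltyIntegrand]
  linarith

lemma g_le_lagrangian {S : ℝ → ℝ} (hS : IsRegularSpectrum S) (P : ℝ) {h : ℕ} {lam : ℝ}
    (η : Fin h → ℝ) (η₀ : ℝ) (hlam : 0 < lam) {a b : ℝ → ℝ} (hab : MemGamma a b) :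
    (g S P h lam η η₀ : EReal) ≤ lagrangian S P h a b lam η η₀ := by
  rcases hab.rate_eq_bot_or with h0 | ⟨hlog, hpos⟩
  · rw [lagrangian_eq, h0, EReal.neg_bot, EReal.top_add_coe]
    exact le_top
  rw [hab.lagrangian_eq_coe hlog hpos hS.continuous, g_eq_integral hS P η η₀ hlam,
    EReal.coe_le_coe_iff]
  refine sub_le_sub_right (mul_le_mul_of_nonneg_left ?_ (by positivity)) _
  refine integral_mono_ae (integrable_min_lagrangian hS η η₀ hlam)
    (hab.integrable_lagrangian hlog hS.continuous ..) ?_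
  filter_upwards [hpos] with θ hθ
  refine le_trans ?_ (lagrangian_integrand_ge hS η η₀ hlam hθ)
  have := nuOpt_nonneg (h := h) (η := η) (η₀ := η₀) hlam (hS.pos θ)
  exact le_add_of_nonneg_right (by positivity)

/-- Equality of the integrals forces the quadratic excess to vanish a.e.; its weight `ν/2` is
positive a.e., so both components are determined. -/
lemma lagrangian_eq_g_iff {S : ℝ → ℝ} (hS : IsRegularSpectrum S) (P : ℝ) {h : ℕ} {lam : ℝ}
    (η : Fin h → ℝ) (η₀ : ℝ) (hlam : 0 < lam) {a b : ℝ → ℝ} (hab : MemGamma a b) :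
    lagrangian S P h a b lam η η₀ = (g S P h lam η η₀ : EReal) ↔
      IsDualFilter S h lam η η₀ (nuOpt S h lam η η₀) a b := by
  refine ⟨fun he => ?_, lagrangian_of_isDualFilter hS P η η₀ hlam⟩
  rcases hab.rate_eq_bot_or with h0 | ⟨hlog, hpos⟩
  · rw [lagrangian_eq, h0, EReal.neg_bot, EReal.top_add_coe] at he
    exact absurd he.symm (EReal.coe_ne_top _)
  rw [hab.lagrangian_eq_coe hlog hpos hS.continuous, g_eq_integral hS P η η₀ hlam,
    EReal.coe_eq_coe_iff, sub_left_inj, mul_right_inj' (by positivity)] at he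
  have hle : ∀ᵐ θ ∂circ, gIntegrand S h lam η η₀ θ + 1 / 2
      + (dualX S h lam η η₀ θ - 2 * lam * S θ) ≤
      -(1 / 2 * Real.log ((1 + a θ) ^ 2 + b θ ^ 2)) + penaltyIntegrand S h a b lam η η₀ θ := by
    filter_upwards [hpos] with θ hθ
    refine le_trans ?_ (lagrangian_integrand_ge hS η η₀ hlam hθ)
    have := nuOpt_nonneg (h := h) (η := η) (η₀ := η₀) hlam (hS.pos θ)
    exact le_add_of_nonneg_right (by positivity)
  have heq := (integral_eq_iff_of_ae_le (integrable_min_lagrangian hS η η₀ hlam)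
    (hab.integrable_lagrangian hlog hS.continuous ..) hle).1 he.symm
  rw [isDualFilter_iff]
  filter_upwards [heq, hpos, hS.rsq_ne_zero η η₀ hlam] with θ h1 h2 h3
  have h4 := lagrangian_integrand_ge hS η η₀ hlam h2
  have h5 := nuOpt_pos hlam (hS.pos θ) h3
  set ν := nuOpt S h lam η η₀ θ
  set u := 1 + a θ - dualX S h lam η η₀ θ / ν with hu
  set v := b θ - dualY h η θ / ν with hv
  have h6 : ν / 2 * (u ^ 2 + v ^ 2) ≤ 0 := by linarith
  have h7 : u ^ 2 + v ^ 2 = 0 :=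
    le_antisymm (nonpos_of_mul_nonpos_right h6 (by positivity)) (by positivity)
  rw [add_eq_zero_iff_of_nonneg (sq_nonneg _) (sq_nonneg _), pow_eq_zero_iff two_ne_zero,
    pow_eq_zero_iff two_ne_zero, hu, hv, sub_eq_zero, sub_eq_zero] at h7
  exact h7

lemma isDualFilter_self {S : ℝ → ℝ} {h : ℕ} {lam : ℝ}
    (η : Fin h → ℝ) (η₀ : ℝ) (ν : ℝ → ℝ) : IsDualFilter S h lam η η₀ ν
    (fun θ => dualX S h lam η η₀ θ / ν θ - 1) (fun θ => dualY h η θ / ν θ) :=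
  ⟨Filter.Eventually.of_forall fun _ => rfl, Filter.Eventually.of_forall fun _ => rfl⟩

lemma lagrangeDual_eq_g {S : ℝ → ℝ} (hS : IsRegularSpectrum S) (P : ℝ) {h : ℕ} {lam : ℝ}
    (η : Fin h → ℝ) (η₀ : ℝ) (hlam : 0 < lam) :
    lagrangeDual S P h lam η η₀ = (g S P h lam η η₀ : EReal) := by
  refine le_antisymm ?_ (le_iInf fun a => le_iInf fun b => le_iInf fun hab =>
    g_le_lagrangian hS P η η₀ hlam hab)
  have hf := isDualFilter_self (S := S) (lam := lam) η η₀ (nuOpt S h lam η η₀)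
  rw [← lagrangian_of_isDualFilter hS P η η₀ hlam hf]
  exact iInf_le_of_le _ <| iInf_le_of_le _ <| iInf_le _
    (memGamma_of_isDualFilter hS η η₀ hlam hf)

/-! ### Trigonometric test filters -/

lemma memGamma_of_continuous {a b : ℝ → ℝ} (ha : Continuous a) (hb : Continuous b) :
    MemGamma a b :=
  ⟨(memLp_two_iff_integrable_sq ha.aestronglyMeasurable).2
      (integrable_circ_of_continuousOn (ha.pow 2).continuousOn),
    (memLp_two_iff_integrable_sq hb.aestronglyMeasurable).2
      (integrable_circ_of_continuousOn (hb.pow 2).continuousOn)⟩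

lemma memGamma_trig (t : ℝ) (n : ℕ) :
    MemGamma (fun θ => t * Real.cos (n * θ)) (fun θ => t * Real.sin (n * θ)) :=
  memGamma_of_continuous (by fun_prop) (by fun_prop)

/-- The filter is `a + jb = t e^{jnθ}`, so the integrand collapses to `t cos ((n - m)θ)`. -/
lemma causality_trig (t : ℝ) (n m : ℕ) :
    causality (fun θ => t * Real.cos (n * θ)) (fun θ => t * Real.sin (n * θ)) m =
      if n = m then 2 * Real.pi * t else 0 := by
  rw [(memGamma_trig t n).causality_eq]
  have e : ∀ θ : ℝ, t * Real.cos (n * θ) * Real.cos (m * θ)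
      + t * Real.sin (n * θ) * Real.sin (m * θ) = t * Real.cos ((n - m : ℝ) * θ) := by
    intro θ
    rw [sub_mul, Real.cos_sub]
    ring
  simp_rw [e]
  rw [integral_const_mul, integral_circ_cos_sub]
  split_ifs <;> ring

lemma power_trig (S : ℝ → ℝ) (t : ℝ) (n : ℕ) :
    power S (fun θ => t * Real.cos (n * θ)) (fun θ => t * Real.sin (n * θ)) =
      t ^ 2 * (1 / (2 * Real.pi) * ∫ θ, S θ ∂circ) := by
  have e : ∀ θ : ℝ, ((t * Real.cos (n * θ)) ^ 2 + (t * Real.sin (n * θ)) ^ 2) * S θ =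
      t ^ 2 * S θ := by
    intro θ
    linear_combination t ^ 2 * S θ * Real.cos_sq_add_sin_sq (n * θ)
  rw [power]
  simp_rw [e]
  rw [integral_const_mul]
  ring

/-- This is the reverse triangle inequality `|1 + t e^{jnθ}| ≥ |1 - |t||`. -/
lemma le_rate_trig {t : ℝ} (ht : |t| ≠ 1) (n : ℕ) :
    ((1 / 2 * Real.log ((1 - |t|) ^ 2) : ℝ) : EReal) ≤
      rate (fun θ => t * Real.cos (n * θ)) (fun θ => t * Real.sin (n * θ)) := by
  have hpos : 0 < (1 - |t|) ^ 2 := by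
    have : 1 - |t| ≠ 0 := sub_ne_zero.2 ht.symm
    positivity
  have hle : ∀ θ : ℝ, (Real.log ((1 - |t|) ^ 2) : EReal) ≤
      elog ((1 + t * Real.cos (n * θ)) ^ 2 + (t * Real.sin (n * θ)) ^ 2) := by
    intro θ
    rw [← elog_of_pos hpos]
    refine elog_mono ?_
    have h1 : |t * Real.cos (n * θ)| ≤ |t| := by
      rw [abs_mul]
      exact mul_le_of_le_one_right (abs_nonneg _) (Real.abs_cos_le_one _)
    have h2 := (abs_le.1 h1).1
    have h3 := Real.cos_sq_add_sin_sq (n * θ)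
    have h4 := sq_abs t
    have h5 : (1 + t * Real.cos (n * θ)) ^ 2 + (t * Real.sin (n * θ)) ^ 2 =
        1 + 2 * (t * Real.cos (n * θ)) + t ^ 2 := by linear_combination t ^ 2 * h3
    rw [h5]
    linarith
  have hint := extIntegral_mono_ae (Filter.Eventually.of_forall hle)
  rw [extIntegral_coe (integrable_const _)] at hint
  refine le_trans (le_of_eq ?_) (mul_le_mul_of_nonneg_left hint ?_)
  · rw [← EReal.coe_mul, integral_const, circ_real_univ, smul_eq_mul]
    congr 1
    field_simp
    ring
  · exact_mod_cast by positivity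

lemma lagrangeDual_le_trig (S : ℝ → ℝ) (P : ℝ) {h : ℕ} (lam : ℝ) (η : Fin h → ℝ) (η₀ : ℝ)
    {t : ℝ} (ht : |t| ≠ 1) (n : ℕ) :
    lagrangeDual S P h lam η η₀ ≤ ((-(1 / 2 * Real.log ((1 - |t|) ^ 2)) +
      penalty S P h (fun θ => t * Real.cos (n * θ)) (fun θ => t * Real.sin (n * θ)) lam η η₀ : ℝ) :
        EReal) := by
  have hle : lagrangeDual S P h lam η η₀ ≤ lagrangian S P h (fun θ => t * Real.cos (n * θ))
      (fun θ => t * Real.sin (n * θ)) lam η η₀ :=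
    iInf_le_of_le _ <| iInf_le_of_le _ <| iInf_le _ (memGamma_trig t n)
  refine hle.trans ?_
  rw [lagrangian_eq, EReal.coe_add, EReal.coe_neg]
  gcongr
  exact EReal.neg_le_neg_iff.2 (le_rate_trig ht n)

lemma lagrangeDual_zero (S : ℝ → ℝ) (P : ℝ) {h : ℕ} (η : Fin h → ℝ) (η₀ : ℝ) :
    lagrangeDual S P h 0 η η₀ = ⊥ := by
  refine EReal.eq_bot_iff_forall_lt _ |>.2 fun y => ?_
  -- At frequency `h + 1` and `λ = 0` the penalty vanishes; this `t` makes the bound on the dual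
  -- equal to `y - 1`.
  set t := 1 + Real.exp (1 - y) with ht
  have he := Real.exp_pos (1 - y)
  have habs : |t| = t := abs_of_pos (by positivity)
  refine (lagrangeDual_le_trig S P 0 η η₀ (t := t) (by rw [habs]; linarith) (h + 1)).trans_lt ?_
  rw [EReal.coe_lt_coe_iff]
  have hpen : penalty S P h (fun θ => t * Real.cos ((h + 1 : ℕ) * θ))
      (fun θ => t * Real.sin ((h + 1 : ℕ) * θ)) 0 η η₀ = 0 := by
    have hne : ∀ i : Fin h, h ≠ (i : ℕ) := fun i => i.2.ne'
    simp only [penalty, causality_trig]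
    simp [hne]
  have hlog : Real.log ((1 - |t|) ^ 2) = 2 * (1 - y) := by
    rw [habs, show (1 - t) ^ 2 = Real.exp (1 - y) ^ 2 by rw [ht]; ring, Real.log_pow,
      Real.log_exp]
    norm_num
  rw [hpen, hlog]
  linarith

/-! ### Existence of optimal multipliers -/

/-- Coercivity: a test filter of amplitude `ε`, with sign matched to one multiplier, uses at most
half the power and charges that multiplier alone. -/
lemma exists_lagrangeDual_le {S : ℝ → ℝ} (hS : ∀ θ, 0 < S θ) {P : ℝ} (hP : 0 < P) (h : ℕ) :
    ∃ C ε : ℝ, 0 < ε ∧ ∀ (lam : ℝ) (η : Fin h → ℝ) (η₀ : ℝ), 0 ≤ lam →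
      lagrangeDual S P h lam η η₀ ≤ ((C - lam * (P / 2) - ε * |η₀| : ℝ) : EReal) ∧
      ∀ i, lagrangeDual S P h lam η η₀ ≤ ((C - lam * (P / 2) - ε * |η i| : ℝ) : EReal) := by
  set A := 1 / (2 * Real.pi) * ∫ θ, S θ ∂circ with hA
  have hA0 : 0 ≤ A := mul_nonneg (by positivity) (integral_nonneg fun θ => (hS θ).le)
  -- The first bound keeps `|t| ≠ 1`; both together give `ε²A ≤ P/2`.
  set ε := min (1 / 2) (P / (A + 1)) with hε
  have hε0 : 0 < ε := lt_min (by norm_num) (by positivity)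
  have hε1 : ε ≤ 1 / 2 := min_le_left _ _
  have hε2 : ε * (A + 1) ≤ P := (le_div_iff₀ (by positivity)).1 (min_le_right _ _)
  have hpow : ε ^ 2 * A ≤ P / 2 := by nlinarith
  have hsign : ∀ x : ℝ, ∃ t : ℝ, |t| = ε ∧ x * t = ε * |x| := by
    intro x
    rcases le_total 0 x with hx | hx
    · exact ⟨ε, abs_of_pos hε0, by rw [abs_of_nonneg hx]; ring⟩
    · exact ⟨-ε, by rw [abs_neg, abs_of_pos hε0], by rw [abs_of_nonpos hx]; ring⟩
  have hsq : ∀ {t : ℝ}, |t| = ε → t ^ 2 = ε ^ 2 := fun {t} ht => by rw [← ht, sq_abs]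
  have hpi := Real.pi_pos.ne'
  refine ⟨-(1 / 2 * Real.log ((1 - ε) ^ 2)), ε, hε0, fun lam η η₀ hlam => ?_⟩
  have hl : lam * (ε ^ 2 * A - P) ≤ -(lam * (P / 2)) := by nlinarith
  constructor
  · obtain ⟨t, ht, hxt⟩ := hsign η₀
    refine (lagrangeDual_le_trig S P lam η η₀ (t := t) (by rw [ht]; linarith) 0).trans ?_
    rw [EReal.coe_le_coe_iff, penalty, power_trig, ht, hsq ht, ← hA]
    have hs : ∑ i : Fin h, η i * (1 / (2 * Real.pi) *
        causality (fun θ => t * Real.cos ((0 : ℕ) * θ)) (fun θ => t * Real.sin ((0 : ℕ) * θ))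
          ((i : ℕ) + 1)) = 0 :=
      Finset.sum_eq_zero fun i _ => by
        rw [causality_trig, if_neg (by omega), mul_zero, mul_zero]
    have h0 : η₀ * (1 / (2 * Real.pi) * (2 * Real.pi * t)) = η₀ * t := by field_simp
    rw [hs, causality_trig, if_pos rfl, h0, hxt]
    linarith
  · intro k
    obtain ⟨t, ht, hxt⟩ := hsign (η k)
    refine (lagrangeDual_le_trig S P lam η η₀ (t := t) (by rw [ht]; linarith) (k + 1)).trans ?_
    rw [EReal.coe_le_coe_iff, penalty, power_trig, ht, hsq ht, ← hA]
    have hs : ∑ i : Fin h, η i * (1 / (2 * Real.pi) *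
        causality (fun θ => t * Real.cos (((k : ℕ) + 1 : ℕ) * θ))
          (fun θ => t * Real.sin (((k : ℕ) + 1 : ℕ) * θ)) ((i : ℕ) + 1)) = η k * t := by
      rw [Finset.sum_eq_single k]
      · rw [causality_trig, if_pos rfl]
        field_simp
      · intro i _ hik
        have : (k : ℕ) ≠ i := fun hki => hik (Fin.ext hki.symm)
        rw [causality_trig, if_neg (by omega), mul_zero, mul_zero]
      · simp
    rw [hs, causality_trig, if_neg (by omega), hxt]
    linarith

/-- For a fixed filter the Lagrangian is continuous in the multipliers: a finite constant plus a
linear function, or constantly infinite. -/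
lemma upperSemicontinuous_lagrangeDual (S : ℝ → ℝ) (P : ℝ) (h : ℕ) :
    UpperSemicontinuous fun m : ℝ × (Fin h → ℝ) × ℝ => lagrangeDual S P h m.1 m.2.1 m.2.2 := by
  refine upperSemicontinuous_iInf fun a => upperSemicontinuous_iInf fun b =>
    upperSemicontinuous_iInf fun _ => Continuous.upperSemicontinuous ?_
  have hpen : Continuous fun m : ℝ × (Fin h → ℝ) × ℝ => penalty S P h a b m.1 m.2.1 m.2.2 := by
    unfold penalty; fun_prop
  simp_rw [lagrangian_eq]
  induction -rate a b with
  | bot => simpa using continuous_const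
  | top => simpa using continuous_const
  | coe c =>
    simp_rw [← EReal.coe_add]
    exact continuous_coe_real_ereal.comp (continuous_const.add hpen)

lemma exists_isDualOptimal {S : ℝ → ℝ} (hS : IsRegularSpectrum S) {P : ℝ} (hP : 0 < P) (h : ℕ) :
    ∃ (lam : ℝ) (η : Fin h → ℝ) (η₀ : ℝ), IsDualOptimal S P h lam η η₀ := by
  obtain ⟨C, ε, hε, hbound⟩ := exists_lagrangeDual_le hS.pos hP h
  obtain ⟨G, hG⟩ : ∃ G : ℝ, lagrangeDual S P h 1 0 0 = (G : EReal) :=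
    ⟨_, lagrangeDual_eq_g hS P 0 0 one_pos⟩
  -- With this `R`, multipliers outside the box have dual value at most the reference value `G` at
  -- `(1, 0, 0)`.
  obtain ⟨R, hR1, hRP, hRε⟩ : ∃ R : ℝ, 1 ≤ R ∧ C - G ≤ R * (P / 2) ∧ C - G ≤ R * ε :=
    ⟨max 1 (max ((C - G) / (P / 2)) ((C - G) / ε)), le_max_left _ _,
      (div_le_iff₀ (by positivity)).1 ((le_max_left _ _).trans (le_max_right _ _)),
      (div_le_iff₀ hε).1 ((le_max_right _ _).trans (le_max_right _ _))⟩
  obtain ⟨K, hK, hKmem⟩ : ∃ K : Set (ℝ × (Fin h → ℝ) × ℝ), IsCompact K ∧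
      ∀ lam η η₀, (lam, η, η₀) ∈ K ↔ (0 ≤ lam ∧ lam ≤ R) ∧ (∀ i, |η i| ≤ R) ∧ |η₀| ≤ R := by
    refine ⟨Icc 0 R ×ˢ (univ.pi fun _ => Icc (-R) R) ×ˢ Icc (-R) R,
      isCompact_Icc.prod ((isCompact_univ_pi fun _ => isCompact_Icc).prod isCompact_Icc),
      fun lam η η₀ => ?_⟩
    simp only [mem_prod, mem_univ_pi, mem_Icc, abs_le]
  have hmem : ((1, 0, 0) : ℝ × (Fin h → ℝ) × ℝ) ∈ K :=
    (hKmem _ _ _).2 ⟨⟨zero_le_one, hR1⟩, fun i => by simpa using zero_le_one.trans hR1,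
      by simpa using zero_le_one.trans hR1⟩
  obtain ⟨⟨lam₁, η₁, η₁₀⟩, hm, hmax⟩ := ((upperSemicontinuous_lagrangeDual S P h
    ).upperSemicontinuousOn K).exists_isMaxOn ⟨_, hmem⟩ hK
  replace hmax : ∀ (lam : ℝ) (η : Fin h → ℝ) (η₀ : ℝ), (lam, η, η₀) ∈ K →
      lagrangeDual S P h lam η η₀ ≤ lagrangeDual S P h lam₁ η₁ η₁₀ := 
    fun lam η η₀ hK' => isMaxOn_iff.1 hmax (lam, η, η₀) hK'
  have hGle : (G : EReal) ≤ lagrangeDual S P h lam₁ η₁ η₁₀ := by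
    rw [← hG]
    exact hmax 1 0 0 hmem
  have hle : ∀ (lam : ℝ) (η : Fin h → ℝ) (η₀ : ℝ), 0 ≤ lam →
      lagrangeDual S P h lam η η₀ ≤ lagrangeDual S P h lam₁ η₁ η₁₀ := by
    intro lam η η₀ hlam
    rcases le_or_gt (lagrangeDual S P h lam η η₀) G with h0 | h0
    · exact h0.trans hGle
    obtain ⟨hb0, hb⟩ := hbound lam η η₀ hlam
    have hx : ∀ x : ℝ, lagrangeDual S P h lam η η₀ ≤ ((C - lam * (P / 2) - ε * |x| : ℝ) : EReal) →
        lam ≤ R ∧ |x| ≤ R := by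
      intro x hxle
      have h1 : G < C - lam * (P / 2) - ε * |x| := by exact_mod_cast h0.trans_le hxle
      have h2 : 0 ≤ lam * (P / 2) := by positivity
      have h3 : 0 ≤ ε * |x| := by positivity
      constructor
      · by_contra! hlt
        linarith [mul_lt_mul_of_pos_right hlt (half_pos hP)]
      · by_contra! hlt
        linarith [mul_lt_mul_of_pos_right hlt hε]
    exact hmax lam η η₀ ((hKmem _ _ _).2
      ⟨⟨hlam, (hx _ hb0).1⟩, fun i => (hx _ (hb i)).2, (hx _ hb0).2⟩)
  have hlam₁ : 0 < lam₁ := by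
    rcases (((hKmem _ _ _).1 hm).1.1).lt_or_eq with h0 | h0
    · exact h0
    exfalso
    rw [← h0, lagrangeDual_zero] at hGle
    exact absurd (le_bot_iff.1 hGle) (EReal.coe_ne_bot _)
  refine ⟨lam₁, η₁, η₁₀, ?_⟩
  rw [IsDualOptimal]
  refine ⟨hlam₁, fun lam η η₀ hlam => ?_⟩
  have := hle lam η η₀ hlam.le
  rwa [lagrangeDual_eq_g hS P η η₀ hlam, lagrangeDual_eq_g hS P η₁ η₁₀ hlam₁,
    EReal.coe_le_coe_iff] at this

/-! ### Stationarity at optimal multipliers -/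

lemma penalty_add_smul (S : ℝ → ℝ) (P : ℝ) {h : ℕ} (a b : ℝ → ℝ) (lam : ℝ) (η : Fin h → ℝ)
    (η₀ t lam' : ℝ) (η' : Fin h → ℝ) (η₀' : ℝ) :
    penalty S P h a b (lam + t * lam') (η + t • η') (η₀ + t * η₀') =
      penalty S P h a b lam η η₀ + t * penalty S P h a b lam' η' η₀' := by
  simp only [penalty, Pi.add_apply, Pi.smul_apply, smul_eq_mul, add_mul, Finset.sum_add_distrib,
    mul_sub, Finset.mul_sum, mul_assoc]
  ring

lemma penalty_congr_ae (S : ℝ → ℝ) (P : ℝ) {h : ℕ} {a b a' b' : ℝ → ℝ} (ha : a =ᵐ[circ] a')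
    (hb : b =ᵐ[circ] b') (lam : ℝ) (η : Fin h → ℝ) (η₀ : ℝ) :
    penalty S P h a b lam η η₀ = penalty S P h a' b' lam η η₀ := by
  have hpow : power S a b = power S a' b' := by
    rw [power, power]
    congr 1
    refine integral_congr_ae ?_
    filter_upwards [ha, hb] with θ h1 h2
    rw [h1, h2]
  have hcau : causality a b = causality a' b' := by
    funext n
    rw [causality, causality]
    congr 1
    · exact integral_congr_ae (ha.mono fun θ hθ => by simp only [hθ])
    · exact integral_congr_ae (hb.mono fun θ hθ => by simp only [hθ])
  rw [penalty, penalty, hpow, hcau]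

/-- From `a² ≤ 2(1 + a)² + 2`, a bound on `(1 + a)² + b²` controls `a` and `b`. The majorant depends
on the filter only through `M`, as dominated convergence needs. -/
lemma abs_penaltyIntegrand_le {S : ℝ → ℝ} {h : ℕ} {a b : ℝ → ℝ} {lam : ℝ} {η : Fin h → ℝ}
    {η₀ θ M : ℝ} (hS : 0 ≤ S θ) (hM : (1 + a θ) ^ 2 + b θ ^ 2 ≤ M) :
    |penaltyIntegrand S h a b lam η η₀ θ| ≤ (2 * M + 3) *
      (|lam| * S θ + |dualX S h lam η η₀ θ - 2 * lam * S θ| + |dualY h η θ|) := by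
  have hM0 : 0 ≤ M := le_trans (by positivity) hM
  have hsq : a θ ^ 2 + b θ ^ 2 ≤ 2 * M + 3 := by nlinarith [sq_nonneg (a θ + 2), sq_nonneg (b θ)]
  have habs : ∀ x : ℝ, x ^ 2 ≤ 2 * M + 2 → |x| ≤ 2 * M + 3 := fun x hx => by
    nlinarith [sq_abs x, sq_nonneg (|x| - 1)]
  have ha : |a θ| ≤ 2 * M + 3 :=
    habs _ (by nlinarith [sq_nonneg (a θ + 2), sq_nonneg (b θ)])
  have hb : |b θ| ≤ 2 * M + 3 := habs _ (by nlinarith [sq_nonneg (1 + a θ)])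
  rw [penaltyIntegrand]
  refine (abs_sub _ _).trans ((add_le_add_left (abs_sub _ _) _).trans ?_)
  rw [abs_mul, abs_mul, abs_mul, abs_mul, abs_of_nonneg (by positivity : 0 ≤ a θ ^ 2 + b θ ^ 2),
    abs_of_nonneg hS, mul_add, mul_add]
  have h1 : |lam| * ((a θ ^ 2 + b θ ^ 2) * S θ) ≤ (2 * M + 3) * (|lam| * S θ) := by
    rw [mul_left_comm]
    exact mul_le_mul_of_nonneg_right hsq (by positivity)
  gcongr

/-- At optimal multipliers the constraint functionals do not increase the Lagrangian in any
direction. -/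
lemma penalty_dualFilter_nonpos {S : ℝ → ℝ} (hS : IsRegularSpectrum S) {P : ℝ} {h : ℕ} {lam : ℝ}
    {η : Fin h → ℝ} {η₀ : ℝ} (hopt : IsDualOptimal S P h lam η η₀)
    (lam' : ℝ) (η' : Fin h → ℝ) (η₀' : ℝ) :
    penalty S P h (fun θ => dualX S h lam η η₀ θ / nuOpt S h lam η η₀ θ - 1)
      (fun θ => dualY h η θ / nuOpt S h lam η η₀ θ) lam' η' η₀' ≤ 0 := by
  obtain ⟨hlam, hmax⟩ := hopt
  set l : ℝ → ℝ := fun t => lam + t * lam' with hl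
  set e : ℝ → Fin h → ℝ := fun t => η + t • η' with he
  set e₀ : ℝ → ℝ := fun t => η₀ + t * η₀' with he₀
  have hl0 : l 0 = lam := by simp [hl]
  have hee0 : e 0 = η := by simp [he]
  have he00 : e₀ 0 = η₀ := by simp [he₀]
  set a : ℝ → ℝ → ℝ := fun t θ =>
    dualX S h (l t) (e t) (e₀ t) θ / nuOpt S h (l t) (e t) (e₀ t) θ - 1 with ha
  set b : ℝ → ℝ → ℝ := fun t θ => dualY h (e t) θ / nuOpt S h (l t) (e t) (e₀ t) θ with hb
  obtain ⟨T, hT0, hTpos⟩ : ∃ T : ℝ, 0 < T ∧ ∀ t ∈ Icc 0 T, 0 < l t := by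
    refine ⟨lam / (2 * (|lam'| + 1)), by positivity, fun t ht => ?_⟩
    have h1 : t * (2 * (|lam'| + 1)) ≤ lam := (le_div_iff₀ (by positivity)).1 ht.2
    have h2 : -(t * |lam'|) ≤ t * lam' := by
      rw [← mul_neg]
      exact mul_le_mul_of_nonneg_left (neg_abs_le _) ht.1
    have h3 := mul_nonneg ht.1 (abs_nonneg lam')
    have h4 := ht.1
    simp only [hl]
    linarith
  have hf : ∀ t, IsDualFilter S h (l t) (e t) (e₀ t) (nuOpt S h (l t) (e t) (e₀ t)) (a t) (b t) :=
    fun t => isDualFilter_self ..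
  have hmem : ∀ t ∈ Icc 0 T, MemGamma (a t) (b t) := fun t ht =>
    memGamma_of_isDualFilter hS _ _ (hTpos t ht) (hf t)
  have hpath : Continuous fun q : ℝ × ℝ =>
      (((l q.1, e q.1, e₀ q.1), q.2) : (ℝ × (Fin h → ℝ) × ℝ) × ℝ) := by
    simp only [hl, he, he₀]; fun_prop
  have hXc := (continuous_dualX_uncurry hS.continuous h).comp hpath
  have hYc := (continuous_dualY_uncurry h).comp hpath
  have hνc := (continuous_nuOpt_uncurry hS.continuous h).comp hpath
  obtain ⟨M, hM⟩ : ∃ M : ℝ, ∀ t ∈ Icc 0 T, ∀ θ ∈ Icc (-Real.pi) Real.pi,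
      (2 * l t * S θ - nuOpt S h (l t) (e t) (e₀ t) θ)⁻¹ ≤ M := by
    have hc : ContinuousOn (fun q : ℝ × ℝ =>
        (2 * l q.1 * S q.2 - nuOpt S h (l q.1) (e q.1) (e₀ q.1) q.2)⁻¹)
        (Icc 0 T ×ˢ Icc (-Real.pi) Real.pi) := by
      refine ContinuousOn.inv₀ (Continuous.continuousOn ?_) fun q hq =>
        (nuOpt_lt (hTpos _ hq.1) (hS.pos _)).ne'
      have hSc := hS.continuous
      refine Continuous.sub ?_ hνc
      simp only [hl]; fun_prop
    obtain ⟨M, hM⟩ := (isCompact_Icc.prod isCompact_Icc).exists_bound_of_continuousOn hc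
    exact ⟨M, fun t ht θ hθ => (le_abs_self _).trans (hM (t, θ) ⟨ht, hθ⟩)⟩
  -- The Lagrangian of the perturbed filter equals `g` at the perturbed multipliers, hence is at
  -- most `g` at the optimum, hence at most its Lagrangian at the unperturbed multipliers. The two
  -- Lagrangians differ by `t` times the penalty in the chosen direction.
  have hnonpos : ∀ t ∈ Ioc 0 T, penalty S P h (a t) (b t) lam' η' η₀' ≤ 0 := by
    intro t ht
    have ht' : t ∈ Icc 0 T := Ioc_subset_Icc_self ht
    have h1 := lagrangian_of_isDualFilter hS P _ _ (hTpos t ht') (hf t)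
    have h2 := g_le_lagrangian hS P η η₀ hlam (hmem t ht')
    have h3 := hmax (l t) (e t) (e₀ t) (hTpos t ht')
    obtain ⟨hlog, hpos⟩ := log_integrable_of_isDualFilter hS _ _ (hTpos t ht') (hf t)
    rw [lagrangian_eq, rate_eq_coe hlog hpos, ← EReal.coe_neg, ← EReal.coe_add] at h1 h2
    rw [EReal.coe_eq_coe_iff, penalty_add_smul] at h1
    rw [EReal.coe_le_coe_iff] at h2
    refine nonpos_of_mul_nonpos_right ?_ ht.1
    linarith
  have hnhds : ∀ᶠ t in nhdsWithin (0 : ℝ) (Ioi 0), t ∈ Ioc 0 T := Ioc_mem_nhdsGT hT0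
  have hpi : ∀ t ∈ Icc 0 T, penalty S P h (a t) (b t) lam' η' η₀' = 1 / (2 * Real.pi) *
      ∫ θ, penaltyIntegrand S h (a t) (b t) lam' η' η₀' θ ∂circ - lam' * P := fun t ht =>
    (hmem t ht).penalty_eq hS.continuous P lam' η' η₀'
  have hlim : Filter.Tendsto
      (fun t => ∫ θ, penaltyIntegrand S h (a t) (b t) lam' η' η₀' θ ∂circ)
      (nhdsWithin (0 : ℝ) (Ioi 0))
      (nhds (∫ θ, penaltyIntegrand S h (a 0) (b 0) lam' η' η₀' θ ∂circ)) := by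
    refine tendsto_integral_filter_of_dominated_convergence (fun θ => (2 * M + 3) *
      (|lam'| * S θ + |dualX S h lam' η' η₀' θ - 2 * lam' * S θ| + |dualY h η' θ|)) ?_ ?_ ?_ ?_
    · filter_upwards [hnhds] with t ht
      exact ((hmem t (Ioc_subset_Icc_self ht)).integrable_penaltyIntegrand hS.continuous
        ..).aestronglyMeasurable
    · filter_upwards [hnhds] with t ht
      have ht' : t ∈ Icc 0 T := Ioc_subset_Icc_self ht
      have hIcc : ∀ᵐ θ ∂circ, θ ∈ Icc (-Real.pi) Real.pi := ae_circ_of_forall fun θ hθ => hθ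
      filter_upwards [hIcc, hS.rsq_ne_zero (e t) (e₀ t) (hTpos t ht')] with θ hθ hr
      refine abs_penaltyIntegrand_le (hS.pos θ).le ?_
      refine le_trans (le_of_eq ?_) (hM t ht' θ hθ)
      rw [← sq_add_sq_dualFilter hS (e t) (e₀ t) (hTpos t ht') hr]
      simp only [ha, hb]
      ring
    · have h1 := continuous_dualX lam' η' η₀' hS.continuous
      have h2 := continuous_dualY η'
      have h3 := hS.continuous
      exact integrable_circ_of_continuousOn (by fun_prop)
    -- Only `ν ≠ 0` at `t = 0` is needed for pointwise convergence, and this holds for a.e. `θ`.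
    · filter_upwards [hS.rsq_ne_zero η η₀ hlam] with θ hr
      have hν0 : nuOpt S h (l 0) (e 0) (e₀ 0) θ ≠ 0 := by
        rw [hl0, hee0, he00]
        exact (nuOpt_pos hlam (hS.pos θ) hr).ne'
      have hsec : Continuous fun t : ℝ => (t, θ) := by fun_prop
      have hac : ContinuousAt (fun t => a t θ) 0 :=
        (((hXc.comp hsec).continuousAt).div ((hνc.comp hsec).continuousAt) hν0).sub
          continuousAt_const
      have hbc : ContinuousAt (fun t => b t θ) 0 :=
        ((hYc.comp hsec).continuousAt).div ((hνc.comp hsec).continuousAt) hν0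
      have hpc : ContinuousAt (fun t => penaltyIntegrand S h (a t) (b t) lam' η' η₀' θ) 0 := by
        unfold penaltyIntegrand
        fun_prop
      exact hpc.tendsto.mono_left nhdsWithin_le_nhds
  have hlim' := ((hlim.const_mul (1 / (2 * Real.pi))).sub_const (lam' * P))
  rw [← hpi 0 ⟨le_rfl, hT0.le⟩] at hlim'
  have hfin : penalty S P h (a 0) (b 0) lam' η' η₀' ≤ 0 := by
    refine le_of_tendsto hlim' ?_
    filter_upwards [hnhds] with t ht
    rw [← hpi t (Ioc_subset_Icc_self ht)]
    exact hnonpos t ht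
  simpa only [ha, hb, hl0, hee0, he00] using hfin

/-- The penalty is linear in the multipliers, so nonpositivity in a direction and its opposite gives
equality. Since `λ > 0`, both directions of `λ` are available, so the power constraint is tight. -/
lemma penalty_eq_zero_of_isDualOptimal {S : ℝ → ℝ} (hS : IsRegularSpectrum S) {P : ℝ} {h : ℕ}
    {lam : ℝ} {η : Fin h → ℝ} {η₀ : ℝ} (hopt : IsDualOptimal S P h lam η η₀) {a b : ℝ → ℝ}
    (hf : IsDualFilter S h lam η η₀ (nuOpt S h lam η η₀) a b)
    (lam' : ℝ) (η' : Fin h → ℝ) (η₀' : ℝ) : penalty S P h a b lam' η' η₀' = 0 := by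
  rw [penalty_congr_ae S P hf.1 hf.2]
  refine le_antisymm (penalty_dualFilter_nonpos hS hopt lam' η' η₀') ?_
  have h1 := penalty_dualFilter_nonpos hS hopt (-lam') (-η') (-η₀')
  have h2 := penalty_add_smul S P (fun θ => dualX S h lam η η₀ θ / nuOpt S h lam η η₀ θ - 1)
    (fun θ => dualY h η θ / nuOpt S h lam η η₀ θ) 0 (0 : Fin h → ℝ) 0 (-1) lam' η' η₀'
  have h3 : penalty S P h (fun θ => dualX S h lam η η₀ θ / nuOpt S h lam η η₀ θ - 1)
    (fun θ => dualY h η θ / nuOpt S h lam η η₀ θ) 0 0 0 = 0 := by simp [penalty]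
  rw [h3] at h2
  simp only [zero_add, neg_one_mul, neg_one_smul] at h2
  linarith

lemma isFeasible_of_isDualOptimal {S : ℝ → ℝ} (hS : IsRegularSpectrum S) {P : ℝ} {h : ℕ}
    {lam : ℝ} {η : Fin h → ℝ} {η₀ : ℝ} (hopt : IsDualOptimal S P h lam η η₀) {a b : ℝ → ℝ}
    (hf : IsDualFilter S h lam η η₀ (nuOpt S h lam η η₀) a b) : IsFeasible S P h a b := by
  have hpen := penalty_eq_zero_of_isDualOptimal hS hopt hf
  refine ⟨memGamma_of_isDualFilter hS η η₀ hopt.1 hf, ?_, fun n hn => ?_⟩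
  · have := hpen 1 0 0
    simp only [penalty, Pi.zero_apply, zero_mul, Finset.sum_const_zero] at this
    linarith
  · rcases n with _ | n
    · have := hpen 0 0 1
      simpa [penalty, Real.pi_ne_zero] using this
    · have := hpen 0 (Pi.single ⟨n, hn⟩ 1) 0
      simpa [penalty, Pi.single_apply, Real.pi_ne_zero] using this

/-! ### Strong duality -/

lemma penalty_nonpos_of_isFeasible {S : ℝ → ℝ} {P : ℝ} {h : ℕ} {a b : ℝ → ℝ}
    (hab : IsFeasible S P h a b) {lam : ℝ} (hlam : 0 ≤ lam) (η : Fin h → ℝ) (η₀ : ℝ) :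
    penalty S P h a b lam η η₀ ≤ 0 := by
  obtain ⟨-, hpow, hcau⟩ := hab
  have hs : ∑ i : Fin h, η i * (1 / (2 * Real.pi) * causality a b ((i : ℕ) + 1)) = 0 :=
    Finset.sum_eq_zero fun i _ => by rw [hcau _ (by omega), mul_zero, mul_zero]
  rw [penalty, hs, hcau 0 (Nat.zero_le _), mul_zero, mul_zero, sub_zero, sub_zero]
  exact mul_nonpos_of_nonneg_of_nonpos hlam (by linarith)

lemma lagrangian_le_neg_rate {S : ℝ → ℝ} {P : ℝ} {h : ℕ} {a b : ℝ → ℝ}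
    (hab : IsFeasible S P h a b) {lam : ℝ} (hlam : 0 ≤ lam) (η : Fin h → ℝ) (η₀ : ℝ) :
    lagrangian S P h a b lam η η₀ ≤ -rate a b := by
  rw [lagrangian_eq]
  refine (add_le_add_right (EReal.coe_le_coe_iff.2
    (penalty_nonpos_of_isFeasible hab hlam η η₀)) _).trans ?_
  rw [EReal.coe_zero, add_zero]

lemma rate_le_of_isFeasible {S : ℝ → ℝ} (hS : IsRegularSpectrum S) {P : ℝ} {h : ℕ}
    {a b : ℝ → ℝ} (hab : IsFeasible S P h a b) {lam : ℝ} (hlam : 0 < lam) (η : Fin h → ℝ)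
    (η₀ : ℝ) : rate a b ≤ ((-g S P h lam η η₀ : ℝ) : EReal) := by
  rw [EReal.coe_neg, EReal.le_neg]
  exact (g_le_lagrangian hS P η η₀ hlam hab.1).trans (lagrangian_le_neg_rate hab hlam.le η η₀)

section strongDuality

variable {S : ℝ → ℝ} {P : ℝ} {h : ℕ} {lam : ℝ} {η : Fin h → ℝ} {η₀ : ℝ}

lemma rate_of_isDualFilter (hS : IsRegularSpectrum S) (hopt : IsDualOptimal S P h lam η η₀)
    {a b : ℝ → ℝ} (hf : IsDualFilter S h lam η η₀ (nuOpt S h lam η η₀) a b) :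
    rate a b = ((-g S P h lam η η₀ : ℝ) : EReal) := by
  have h1 := lagrangian_of_isDualFilter hS P η η₀ hopt.1 hf
  rw [lagrangian_eq, penalty_eq_zero_of_isDualOptimal hS hopt hf, EReal.coe_zero, add_zero] at h1
  rw [EReal.coe_neg, ← h1, neg_neg]

lemma Cfb_eq_neg_g (hS : IsRegularSpectrum S) (hopt : IsDualOptimal S P h lam η η₀) :
    Cfb S P h = ((-g S P h lam η η₀ : ℝ) : EReal) := by
  refine le_antisymm (iSup_le fun a => iSup_le fun b => iSup_le fun hab =>
    rate_le_of_isFeasible hS hab hopt.1 η η₀) ?_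
  have hf := isDualFilter_self (S := S) (lam := lam) η η₀ (nuOpt S h lam η η₀)
  rw [← rate_of_isDualFilter hS hopt hf]
  exact le_iSup_of_le _ <| le_iSup_of_le _ <| le_iSup_of_le
    (isFeasible_of_isDualOptimal hS hopt hf) le_rfl

/-- With no gap, an optimal filter must minimise the Lagrangian at every optimal multiplier, and
that minimiser is unique a.e. -/
lemma isOptimalFilter_iff (hS : IsRegularSpectrum S) (hopt : IsDualOptimal S P h lam η η₀)
    (a b : ℝ → ℝ) : IsOptimalFilter S P h a b ↔
      IsDualFilter S h lam η η₀ (nuOpt S h lam η η₀) a b := by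
  constructor
  · rintro ⟨hab, hrate⟩
    rw [← lagrangian_eq_g_iff hS P η η₀ hopt.1 hab.1]
    refine le_antisymm ?_ (g_le_lagrangian hS P η η₀ hopt.1 hab.1)
    refine (lagrangian_le_neg_rate hab hopt.1.le η η₀).trans_eq ?_
    rw [hrate, Cfb_eq_neg_g hS hopt, ← EReal.coe_neg, neg_neg]
  · intro hf
    exact ⟨isFeasible_of_isDualOptimal hS hopt hf, by
      rw [rate_of_isDualFilter hS hopt hf, Cfb_eq_neg_g hS hopt]⟩

end strongDuality

/-! ### The dual with free `ν` -/

/-- The integrand of `gTilde`. -/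
def gTildeIntegrand (S : ℝ → ℝ) (h : ℕ) (lam : ℝ) (η : Fin h → ℝ) (η₀ : ℝ) (ν : ℝ → ℝ)
    (θ : ℝ) : EReal :=
  freeIntegrand (2 * lam * S θ) (rsq S h lam η η₀ θ) (lam * S θ) (ν θ)

lemma gTilde_eq (S : ℝ → ℝ) (P : ℝ) (h : ℕ) (lam : ℝ) (η : Fin h → ℝ) (η₀ : ℝ) (ν : ℝ → ℝ) :
    gTilde S P h lam η η₀ ν = ((1 / (2 * Real.pi) : ℝ) : EReal) *
      extIntegral (gTildeIntegrand S h lam η η₀ ν) + ((-lam * P + η₀ + 1 / 2 : ℝ) : EReal) := rfl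

lemma gTilde_eq_coe {S : ℝ → ℝ} {P : ℝ} {h : ℕ} {lam : ℝ} {η : Fin h → ℝ} {η₀ : ℝ} {ν ψ : ℝ → ℝ}
    (hψ : Integrable ψ circ) (he : ∀ᵐ θ ∂circ, gTildeIntegrand S h lam η η₀ ν θ = ψ θ) :
    gTilde S P h lam η η₀ ν =
      ((1 / (2 * Real.pi) * ∫ θ, ψ θ ∂circ + (-lam * P + η₀ + 1 / 2) : ℝ) : EReal) := by
  rw [gTilde_eq, extIntegral_congr_ae he, extIntegral_coe hψ, ← EReal.coe_mul, ← EReal.coe_add]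

lemma le_gTilde {S : ℝ → ℝ} {P : ℝ} {h : ℕ} {lam : ℝ} {η : Fin h → ℝ} {η₀ : ℝ} {ν ψ : ℝ → ℝ}
    (hψ : Integrable ψ circ) (he : ∀ᵐ θ ∂circ, ψ θ ≤ gTildeIntegrand S h lam η η₀ ν θ) :
    ((1 / (2 * Real.pi) * ∫ θ, ψ θ ∂circ + (-lam * P + η₀ + 1 / 2) : ℝ) : EReal) ≤
      gTilde S P h lam η η₀ ν := by
  rw [gTilde_eq, EReal.coe_add, EReal.coe_mul, ← extIntegral_coe hψ]
  gcongr
  exact extIntegral_mono_ae he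

lemma isAdmissibleNu_nuOpt {S : ℝ → ℝ} (hS : IsRegularSpectrum S) {h : ℕ} {lam : ℝ}
    (η : Fin h → ℝ) (η₀ : ℝ) (hlam : 0 < lam) : IsAdmissibleNu (nuOpt S h lam η η₀) :=
  ⟨(continuous_nuOpt lam η η₀ hS.continuous).continuousOn, fun θ _ => nuOpt_nonneg hlam (hS.pos θ)⟩

lemma gTildeIntegrand_le {S : ℝ → ℝ} (hS : IsRegularSpectrum S) {h : ℕ} {lam : ℝ}
    (η : Fin h → ℝ) (η₀ : ℝ) (hlam : 0 < lam) {ν : ℝ → ℝ} (hν : IsAdmissibleNu ν) :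
    ∀ᵐ θ ∂circ, gTildeIntegrand S h lam η η₀ ν θ ≤ (gIntegrand S h lam η η₀ θ : EReal) := by
  refine ae_circ_of_forall fun θ hθ => ?_
  rw [gIntegrand_eq hS η η₀ hlam]
  exact freeIntegrand_le (rsq_nonneg ..) (nuOpt_sq hlam (hS.pos θ)) (nuOpt_lt hlam (hS.pos θ))
    (hν.2 θ hθ)

lemma aemeasurable_gTildeIntegrand {S : ℝ → ℝ} (hS : Continuous S) {h : ℕ} (lam : ℝ)
    (η : Fin h → ℝ) (η₀ : ℝ) {ν : ℝ → ℝ} (hν : IsAdmissibleNu ν) :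
    AEMeasurable (gTildeIntegrand S h lam η η₀ ν) circ := by
  have h1 : AEMeasurable ν circ := aemeasurable_circ_of_continuousOn hν.1
  have h2 : AEMeasurable S circ := hS.aemeasurable
  have h3 : AEMeasurable (rsq S h lam η η₀) circ :=
    (((continuous_dualX lam η η₀ hS).pow 2).add ((continuous_dualY η).pow 2)).aemeasurable
  have h4 : AEMeasurable (fun θ => ((1 / 2 : ℝ) : EReal) * elog (2 * lam * S θ - ν θ)) circ :=
    (measurable_elog.comp_aemeasurable ((h2.const_mul _).sub h1)).const_mul _
  have h5 : AEMeasurable (fun θ => -((ENNReal.ofReal (rsq S h lam η η₀ θ) /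
      ENNReal.ofReal (2 * ν θ) : ENNReal) : EReal)) circ :=
    (continuous_neg.measurable.comp measurable_coe_ennreal_ereal).comp_aemeasurable
      (h3.ennreal_ofReal.div (h1.const_mul 2).ennreal_ofReal)
  exact (h4.add h5).add (measurable_coe_real_ereal.comp_aemeasurable (h2.const_mul lam))

lemma gTilde_eq_bot_or {S : ℝ → ℝ} (hS : IsRegularSpectrum S) (P : ℝ) {h : ℕ} {lam : ℝ}
    (η : Fin h → ℝ) (η₀ : ℝ) (hlam : 0 < lam) {ν : ℝ → ℝ} (hν : IsAdmissibleNu ν) :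
    gTilde S P h lam η η₀ ν = ⊥ ∨ ∃ ψ : ℝ → ℝ, Integrable ψ circ ∧
      ∀ᵐ θ ∂circ, gTildeIntegrand S h lam η η₀ ν θ = ψ θ := by
  rcases extIntegral_eq_bot_or (aemeasurable_gTildeIntegrand hS.continuous lam η η₀ hν)
    (integrable_gIntegrand hS η η₀ hlam) (gTildeIntegrand_le hS η η₀ hlam hν) with h0 | h0
  · left
    rw [gTilde_eq, h0, EReal.coe_mul_bot_of_pos (by positivity), EReal.bot_add]
  · exact Or.inr h0

lemma g_eq_add (S : ℝ → ℝ) (P : ℝ) {h : ℕ} (lam : ℝ) (η : Fin h → ℝ) (η₀ : ℝ) :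
    g S P h lam η η₀ = 1 / (2 * Real.pi) * ∫ θ, gIntegrand S h lam η η₀ θ ∂circ
      + (-lam * P + η₀ + 1 / 2) := by
  rw [g]; ring

lemma gTilde_of_eqOn {S : ℝ → ℝ} (hS : IsRegularSpectrum S) (P : ℝ) {h : ℕ} {lam : ℝ}
    (η : Fin h → ℝ) (η₀ : ℝ) (hlam : 0 < lam) {ν : ℝ → ℝ}
    (hν : EqOn ν (nuOpt S h lam η η₀) (Icc (-Real.pi) Real.pi)) :
    gTilde S P h lam η η₀ ν = (g S P h lam η η₀ : EReal) := by
  rw [g_eq_add]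
  refine gTilde_eq_coe (integrable_gIntegrand hS η η₀ hlam) (ae_circ_of_forall fun θ hθ => ?_)
  rw [gIntegrand_eq hS η η₀ hlam, gTildeIntegrand, hν hθ]
  exact (freeIntegrand_eq_iff (rsq_nonneg ..) (nuOpt_sq hlam (hS.pos θ))
    (nuOpt_lt hlam (hS.pos θ)) (nuOpt_nonneg hlam (hS.pos θ))).2 rfl

lemma gTilde_le_g {S : ℝ → ℝ} (hS : IsRegularSpectrum S) (P : ℝ) {h : ℕ} {lam : ℝ}
    (η : Fin h → ℝ) (η₀ : ℝ) (hlam : 0 < lam) {ν : ℝ → ℝ} (hν : IsAdmissibleNu ν) :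
    gTilde S P h lam η η₀ ν ≤ (g S P h lam η η₀ : EReal) := by
  rw [g_eq_add, EReal.coe_add, EReal.coe_mul,
    ← extIntegral_coe (integrable_gIntegrand hS η η₀ hlam), gTilde_eq]
  gcongr
  exact extIntegral_mono_ae (gTildeIntegrand_le hS η η₀ hlam hν)

lemma gTilde_eq_g_iff {S : ℝ → ℝ} (hS : IsRegularSpectrum S) (P : ℝ) {h : ℕ} {lam : ℝ}
    (η : Fin h → ℝ) (η₀ : ℝ) (hlam : 0 < lam) {ν : ℝ → ℝ} (hν : IsAdmissibleNu ν) :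
    gTilde S P h lam η η₀ ν = (g S P h lam η η₀ : EReal) ↔
      EqOn ν (nuOpt S h lam η η₀) (Icc (-Real.pi) Real.pi) := by
  refine ⟨fun heq => ?_, gTilde_of_eqOn hS P η η₀ hlam⟩
  rcases gTilde_eq_bot_or hS P η η₀ hlam hν with h0 | ⟨ψ, hψ, he⟩
  · rw [h0] at heq
    exact absurd heq (EReal.bot_ne_coe _)
  rw [gTilde_eq_coe hψ he, g_eq_add, EReal.coe_eq_coe_iff, add_left_inj,
    mul_right_inj' (by positivity)] at heq
  have hle : ∀ᵐ θ ∂circ, ψ θ ≤ gIntegrand S h lam η η₀ θ := by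
    filter_upwards [he, gTildeIntegrand_le hS η η₀ hlam hν] with θ h1 h2
    rwa [h1, EReal.coe_le_coe_iff] at h2
  have hae := (integral_eq_iff_of_ae_le hψ (integrable_gIntegrand hS η η₀ hlam) hle).1 heq
  -- Continuity upgrades a.e. equality to equality on the whole interval.
  refine Measure.eqOn_Icc_of_ae_eq volume (by linarith [Real.pi_pos]) ?_ hν.1
    (isAdmissibleNu_nuOpt hS η η₀ hlam).1
  have hnn : ∀ᵐ θ ∂circ, 0 ≤ ν θ := ae_circ_of_forall hν.2
  show ν =ᵐ[circ] _
  filter_upwards [he, hae, hnn] with θ h1 h2 h3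
  rw [h2, gIntegrand_eq hS η η₀ hlam] at h1
  exact (freeIntegrand_eq_iff (rsq_nonneg ..) (nuOpt_sq hlam (hS.pos θ))
    (nuOpt_lt hlam (hS.pos θ)) h3).1 h1

lemma isFreeDualOptimal_iff {S : ℝ → ℝ} (hS : IsRegularSpectrum S) (P : ℝ) {h : ℕ} (lam : ℝ)
    (η : Fin h → ℝ) (η₀ : ℝ) (ν : ℝ → ℝ) :
    IsFreeDualOptimal S P h lam η η₀ ν ↔ IsDualOptimal S P h lam η η₀ ∧
      EqOn ν (nuOpt S h lam η η₀) (Icc (-Real.pi) Real.pi) := by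
  constructor
  · rintro ⟨hlam, hν, hmax⟩
    have hle := gTilde_le_g hS P η η₀ hlam hν
    have hge : ∀ (lam' : ℝ) (η' : Fin h → ℝ) (η₀' : ℝ), 0 < lam' →
        (g S P h lam' η' η₀' : EReal) ≤ gTilde S P h lam η η₀ ν := by
      intro lam' η' η₀' hlam'
      rw [← gTilde_of_eqOn hS P η' η₀' hlam' (eqOn_refl _ _)]
      exact hmax lam' η' η₀' _ hlam' (isAdmissibleNu_nuOpt hS η' η₀' hlam')
    refine ⟨⟨hlam, fun lam' η' η₀' hlam' => ?_⟩, ?_⟩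
    · exact EReal.coe_le_coe_iff.1 ((hge lam' η' η₀' hlam').trans hle)
    · exact (gTilde_eq_g_iff hS P η η₀ hlam hν).1 (le_antisymm hle (hge lam η η₀ hlam))
  · rintro ⟨⟨hlam, hmax⟩, heq⟩
    have hadm := isAdmissibleNu_nuOpt hS η η₀ hlam
    refine ⟨hlam, ⟨hadm.1.congr heq, fun θ hθ => heq hθ ▸ hadm.2 θ hθ⟩, ?_⟩
    intro lam' η' η₀' ν' hlam' hν'
    rw [gTilde_of_eqOn hS P η η₀ hlam heq]
    exact (gTilde_le_g hS P η' η₀' hlam' hν').trans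
      (EReal.coe_le_coe_iff.2 (hmax lam' η' η₀' hlam'))

lemma dualX_combo (S : ℝ → ℝ) {h : ℕ} (lam₁ lam₂ : ℝ) (η₁ η₂ : Fin h → ℝ) (ζ₁ ζ₂ α β θ : ℝ) :
    dualX S h (α * lam₁ + β * lam₂) (α • η₁ + β • η₂) (α * ζ₁ + β * ζ₂) θ =
      α * dualX S h lam₁ η₁ ζ₁ θ + β * dualX S h lam₂ η₂ ζ₂ θ := by
  simp only [dualX, Pi.add_apply, Pi.smul_apply, smul_eq_mul, add_mul, Finset.sum_add_distrib,
    mul_add, Finset.mul_sum, mul_assoc]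
  ring

lemma dualY_combo {h : ℕ} (η₁ η₂ : Fin h → ℝ) (α β θ : ℝ) :
    dualY h (α • η₁ + β • η₂) θ = α * dualY h η₁ θ + β * dualY h η₂ θ := by
  simp only [dualY, Pi.add_apply, Pi.smul_apply, smul_eq_mul, add_mul, Finset.sum_add_distrib,
    Finset.mul_sum, mul_assoc]

lemma IsAdmissibleNu.combo {ν₁ ν₂ : ℝ → ℝ} (h₁ : IsAdmissibleNu ν₁) (h₂ : IsAdmissibleNu ν₂)
    {α β : ℝ} (hα : 0 ≤ α) (hβ : 0 ≤ β) : IsAdmissibleNu (α • ν₁ + β • ν₂) :=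
  ⟨(h₁.1.const_smul α).add (h₂.1.const_smul β), fun θ hθ =>
    add_nonneg (mul_nonneg hα (h₁.2 θ hθ)) (mul_nonneg hβ (h₂.2 θ hθ))⟩

/-- A real number below `gTilde` excludes the value `-∞`, so the integrands at both endpoints are
real a.e. and the pointwise concavity `le_freeIntegrand_combo` can be integrated. -/
lemma convex_hypograph_gTilde {S : ℝ → ℝ} (hS : IsRegularSpectrum S) (P : ℝ) (h : ℕ) :
    Convex ℝ {u : ℝ × (Fin h → ℝ) × ℝ × (ℝ → ℝ) × ℝ |
      0 < u.1 ∧ IsAdmissibleNu u.2.2.2.1 ∧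
      (u.2.2.2.2 : EReal) ≤ gTilde S P h u.1 u.2.1 u.2.2.1 u.2.2.2.1} := by
  rintro ⟨lam₁, η₁, ζ₁, ν₁, t₁⟩ ⟨hlam₁, hν₁, ht₁⟩ ⟨lam₂, η₂, ζ₂, ν₂, t₂⟩ ⟨hlam₂, hν₂, ht₂⟩
    α β hα hβ hαβ
  simp only at hlam₁ hν₁ ht₁ hlam₂ hν₂ ht₂
  refine ⟨(convex_Ioi (0 : ℝ)) hlam₁ hlam₂ hα hβ hαβ, hν₁.combo hν₂ hα hβ, ?_⟩
  show ((α * t₁ + β * t₂ : ℝ) : EReal) ≤ gTilde S P h (α * lam₁ + β * lam₂) (α • η₁ + β • η₂)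
    (α * ζ₁ + β * ζ₂) (α • ν₁ + β • ν₂)
  rcases gTilde_eq_bot_or hS P η₁ ζ₁ hlam₁ hν₁ with h0 | ⟨ψ₁, hψ₁, he₁⟩
  · rw [h0] at ht₁
    exact absurd (le_bot_iff.1 ht₁) (EReal.coe_ne_bot _)
  rcases gTilde_eq_bot_or hS P η₂ ζ₂ hlam₂ hν₂ with h0 | ⟨ψ₂, hψ₂, he₂⟩
  · rw [h0] at ht₂
    exact absurd (le_bot_iff.1 ht₂) (EReal.coe_ne_bot _)
  rw [gTilde_eq_coe hψ₁ he₁, EReal.coe_le_coe_iff] at ht₁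
  rw [gTilde_eq_coe hψ₂ he₂, EReal.coe_le_coe_iff] at ht₂
  have hψ : Integrable (fun θ => α * ψ₁ θ + β * ψ₂ θ) circ :=
    (hψ₁.const_mul α).add (hψ₂.const_mul β)
  refine le_trans ?_ (le_gTilde hψ ?_)
  · rw [EReal.coe_le_coe_iff, integral_add (hψ₁.const_mul α) (hψ₂.const_mul β),
      integral_const_mul, integral_const_mul]
    have h1 := mul_le_mul_of_nonneg_left ht₁ hα
    have h2 := mul_le_mul_of_nonneg_left ht₂ hβ
    have h3 : (1 / 2 : ℝ) = α * (1 / 2) + β * (1 / 2) := by rw [← add_mul, hαβ, one_mul]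
    rw [h3]
    linarith
  · have hn₁ : ∀ᵐ θ ∂circ, 0 ≤ ν₁ θ := ae_circ_of_forall hν₁.2
    have hn₂ : ∀ᵐ θ ∂circ, 0 ≤ ν₂ θ := ae_circ_of_forall hν₂.2
    filter_upwards [he₁, he₂, hn₁, hn₂] with θ h1 h2 h3 h4
    have key := le_freeIntegrand_combo h3 h4 h1 h2 hα hβ hαβ
    rw [gTildeIntegrand, rsq, dualX_combo, dualY_combo]
    convert key using 2
    · ring
    · ring
    · simp

end FeedbackCapacity

end

/-! ### Assembly of the duality statements -/

open FeedbackCapacity in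
theorem mainTheorem1 (H : RatFunc ℝ) (hH : IsCausalStable H)
    (hpos : ∀ θ : ℝ, 0 < psd H θ)
    (hcolored : ¬ ∃ c : ℝ, ∀ θ : ℝ, psd H θ = c)
    (P : ℝ) (hP : 0 < P) (h : ℕ) :
    ∃ μ : ℝ,
      -- (a) the Lagrangian dual is `-μ = max g`
      ((∀ (lam : ℝ) (η : Fin h → ℝ) (η₀ : ℝ), 0 < lam →
          MeasureTheory.Integrable (gIntegrand (psd H) h lam η η₀) circ ∧
          lagrangeDual (psd H) P h lam η η₀ = (g (psd H) P h lam η η₀ : EReal)) ∧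
        (∀ (η : Fin h → ℝ) (η₀ : ℝ), lagrangeDual (psd H) P h 0 η η₀ = ⊥) ∧
        (⨆ (lam : ℝ) (_ : 0 ≤ lam) (η : Fin h → ℝ) (η₀ : ℝ), lagrangeDual (psd H) P h lam η η₀)
          = ((-μ : ℝ) : EReal) ∧
        IsGreatest {v : ℝ | ∃ (lam : ℝ) (η : Fin h → ℝ) (η₀ : ℝ),
          0 < lam ∧ v = g (psd H) P h lam η η₀} (-μ)) ∧
      -- (b) the equivalent convex problem in which `ν` is free: its objective is concave ...
      (Convex ℝ {u : ℝ × (Fin h → ℝ) × ℝ × (ℝ → ℝ) × ℝ |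
          0 < u.1 ∧ IsAdmissibleNu u.2.2.2.1 ∧
          (u.2.2.2.2 : EReal) ≤ gTilde (psd H) P h u.1 u.2.1 u.2.2.1 u.2.2.2.1} ∧
        -- ... it has the same maximum ...
        IsGreatest {v : EReal | ∃ (lam : ℝ) (η : Fin h → ℝ) (η₀ : ℝ) (ν : ℝ → ℝ),
          0 < lam ∧ IsAdmissibleNu ν ∧ v = gTilde (psd H) P h lam η η₀ ν} ((-μ : ℝ) : EReal) ∧
        -- ... and the optimal `ν` is the closed form
        (∀ (lam : ℝ) (η : Fin h → ℝ) (η₀ : ℝ), 0 < lam →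
          IsAdmissibleNu (nuOpt (psd H) h lam η η₀) ∧
          gTilde (psd H) P h lam η η₀ (nuOpt (psd H) h lam η η₀)
            = (g (psd H) P h lam η η₀ : EReal) ∧
          ∀ ν : ℝ → ℝ, IsAdmissibleNu ν →
            gTilde (psd H) P h lam η η₀ ν ≤ (g (psd H) P h lam η η₀ : EReal) ∧
            (gTilde (psd H) P h lam η η₀ ν = (g (psd H) P h lam η η₀ : EReal) ↔
              Set.EqOn ν (nuOpt (psd H) h lam η η₀) (Set.Icc (-Real.pi) Real.pi))) ∧
        (∀ (lam : ℝ) (η : Fin h → ℝ) (η₀ : ℝ) (ν : ℝ → ℝ),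
          IsFreeDualOptimal (psd H) P h lam η η₀ ν ↔
            IsDualOptimal (psd H) P h lam η η₀ ∧
              Set.EqOn ν (nuOpt (psd H) h lam η η₀) (Set.Icc (-Real.pi) Real.pi))) ∧
      -- (c) no duality gap, and the optimal filter
      (Cfb (psd H) P h = (μ : EReal) ∧
        (∃ a b : ℝ → ℝ, IsOptimalFilter (psd H) P h a b) ∧
        (∀ (lam : ℝ) (η : Fin h → ℝ) (η₀ : ℝ), IsDualOptimal (psd H) P h lam η η₀ →
          ∀ a b : ℝ → ℝ, IsOptimalFilter (psd H) P h a b ↔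
            IsDualFilter (psd H) h lam η η₀ (nuOpt (psd H) h lam η η₀) a b) ∧
        (∀ (lam : ℝ) (η : Fin h → ℝ) (η₀ : ℝ) (ν : ℝ → ℝ),
          IsFreeDualOptimal (psd H) P h lam η η₀ ν →
          ∀ a b : ℝ → ℝ, IsOptimalFilter (psd H) P h a b ↔
            IsDualFilter (psd H) h lam η η₀ ν a b)) := by
  have hS := psd_isRegularSpectrum hpos hcolored
  obtain ⟨lam₁, η₁, ζ₁, hopt⟩ := exists_isDualOptimal hS hP h
  have hle : ∀ (lam : ℝ) (η : Fin h → ℝ) (η₀ : ℝ), 0 < lam →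
      g (psd H) P h lam η η₀ ≤ g (psd H) P h lam₁ η₁ ζ₁ := hopt.2
  refine ⟨-g (psd H) P h lam₁ η₁ ζ₁, ⟨?_, ?_, ?_, ?_⟩, ⟨?_, ?_, ?_, ?_⟩, ?_, ?_, ?_, ?_⟩
  · exact fun lam η η₀ hlam =>
      ⟨integrable_gIntegrand hS η η₀ hlam, lagrangeDual_eq_g hS P η η₀ hlam⟩
  · exact fun η η₀ => lagrangeDual_zero (psd H) P η η₀
  · rw [neg_neg]
    refine le_antisymm ?_ ?_
    · refine iSup_le fun lam => iSup_le fun hlam => iSup_le fun η => iSup_le fun η₀ => ?_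
      rcases hlam.eq_or_lt with h0 | h0
      · rw [← h0, lagrangeDual_zero]
        exact bot_le
      · rw [lagrangeDual_eq_g hS P η η₀ h0]
        exact EReal.coe_le_coe_iff.2 (hle lam η η₀ h0)
    · rw [← lagrangeDual_eq_g hS P η₁ ζ₁ hopt.1]
      exact le_iSup_of_le lam₁ <| le_iSup_of_le hopt.1.le <| le_iSup_of_le η₁ <|
        le_iSup_of_le ζ₁ le_rfl
  · rw [neg_neg]
    refine ⟨⟨lam₁, η₁, ζ₁, hopt.1, rfl⟩, ?_⟩
    rintro v ⟨lam, η, η₀, hlam, rfl⟩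
    exact hle lam η η₀ hlam
  · exact convex_hypograph_gTilde hS P h
  · rw [neg_neg]
    refine ⟨⟨lam₁, η₁, ζ₁, _, hopt.1, isAdmissibleNu_nuOpt hS η₁ ζ₁ hopt.1,
      (gTilde_of_eqOn hS P η₁ ζ₁ hopt.1 (Set.eqOn_refl _ _)).symm⟩, ?_⟩
    rintro v ⟨lam, η, η₀, ν, hlam, hν, rfl⟩
    exact (gTilde_le_g hS P η η₀ hlam hν).trans (EReal.coe_le_coe_iff.2 (hle lam η η₀ hlam))
  · exact fun lam η η₀ hlam => ⟨isAdmissibleNu_nuOpt hS η η₀ hlam,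
      gTilde_of_eqOn hS P η η₀ hlam (Set.eqOn_refl _ _), fun ν hν =>
      ⟨gTilde_le_g hS P η η₀ hlam hν, gTilde_eq_g_iff hS P η η₀ hlam hν⟩⟩
  · exact fun lam η η₀ ν => isFreeDualOptimal_iff hS P lam η η₀ ν
  · exact Cfb_eq_neg_g hS hopt
  · exact ⟨_, _, (isOptimalFilter_iff hS hopt _ _).2 (isDualFilter_self η₁ ζ₁ _)⟩
  · exact fun lam η η₀ hdual a b => isOptimalFilter_iff hS hdual a b
  · intro lam η η₀ ν hfree a b
    obtain ⟨hdual, heq⟩ := (isFreeDualOptimal_iff hS P lam η η₀ ν).1 hfree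
    have hae : ∀ᵐ θ ∂circ, ν θ = nuOpt (psd H) h lam η η₀ θ := ae_circ_of_forall heq
    rw [isOptimalFilter_iff hS hdual a b, isDualFilter_iff, isDualFilter_iff]
    refine Filter.eventually_congr (hae.mono fun θ hθ => ?_)
    rw [hθ]
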